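/- Let $K$ be a field and $\delta$ a derivation of $K$ (an additive map with $\delta(ab)=a\delta(b)+\delta(a)b$) with field of constants $\mathrm{Const}(\delta)=\{a\in K:\delta(a)=0\}$. Let $K[t;\delta]$ be the differential polynomial ring: its elements are the polynomials $a_0+a_1t+\dots+a_nt^n$ with $a_i\in K$, added coefficientwise and multiplied according to $ta=at+\delta(a)$ for $a\in K$. For $f\in K[t;\delta]$ of degree $m\ge 1$ and $g\in K[t;\delta]$, let $g \bmod_r f$ be the unique $r$ with $\deg r<m$ and $g-r\in K[t;\delta]f$. The Petit algebra $S_f=K[t;\delta]/K[t;\delta]f$ is the set of all differential polynomials of degree less than $m$ with the usual addition and the multiplication $g\circ h=gh \bmod_r f$; it is a unital nonassociative algebra over $\mathrm{Const}(\delta)$ and contains $K$ as the set of constant polynomials. With $[x,y,z]=(xy)z-x(yz)$, the left, middle and right nucleus of a nonassociative algebra $S$ are $\{x:[x,S,S]=0\}$, $\{x:[S,x,S]=0\}$ and $\{x:[S,S,x]=0\}$. **Theorem.** Let $F$ be a field of characteristic $0$, let $m\ge 2$, and let $B$ be a central simple algebra of degree $m$ over $F$ (that is, $\dim_F B=m^2$).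 Let $K/F$ be a field extension with $K\ne F$ such that $F$ is algebraically closed in $K$ and $K$ splits $B$, i.e. $K\otimes_F B\cong \mathrm{Mat}_m(K)$ as $K$-algebras. Then there are a derivation $\delta$ on $K$ with field of constants $F$ and a differential polynomial $f\in K[t;\delta]$ of degree $m$ such that 1. $S_f$ is infinite-dimensional over $F$; 2. the left nucleus and the middle nucleus of $S_f$ are both equal to $K$; 3. the right nucleus of $S_f$ is isomorphic to $B$ as an $F$-algebra and, when $B$ is identified with the right nucleus through a suitable such isomorphism, every $F$-algebra automorphism of $S_f$ maps $B$ onto itself and restricts to an inner automorphism of $B$. -/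

import Mathlib

open scoped TensorProduct Polynomial

noncomputable section

/-! ### Differential polynomial rings -/

section DifferentialPolynomials

variable {F K : Type*} [CommRing F] [Field K] [Algebra F K]

/-- The underlying set of the differential polynomial ring `K[t;δ]`: polynomials
`a₀ + a₁ t + ⋯ + aₙ tⁿ` with coefficients in `K`, written on the left.
(With `F = ℤ`, `δ` is an arbitrary derivation of `K`.) -/
def DiffPoly (_δ : Derivation F K K) : Type _ := K[X]

namespace DiffPoly

variable {δ : Derivation F K K}

instance : AddCommGroup (DiffPoly δ) := inferInstanceAs (AddCommGroup K[X])
instance : Module K (DiffPoly δ) := inferInstanceAs (Module K K[X])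
instance : Module F (DiffPoly δ) := inferInstanceAs (Module F K[X])
instance : IsScalarTower F K (DiffPoly δ) := inferInstanceAs (IsScalarTower F K K[X])

/-- The list of coefficients of a differential polynomial, as an ordinary polynomial. -/
def toPoly : DiffPoly δ ≃ₗ[K] K[X] := LinearEquiv.refl K K[X]

@[ext] theorem ext {p q : DiffPoly δ} (h : toPoly p = toPoly q) : p = q := toPoly.injective h

theorem toPoly_smul (c : F) (p : DiffPoly δ) : toPoly (c • p) = c • toPoly p := rfl

/-- The degree, with `deg 0 = ⊥`. -/
def degree (p : DiffPoly δ) : WithBot ℕ := (toPoly p).degree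

theorem toPoly_eq_zero {p : DiffPoly δ} : toPoly p = 0 ↔ p = 0 := LinearEquiv.map_eq_zero_iff _

theorem degree_eq_bot {p : DiffPoly δ} : degree p = ⊥ ↔ p = 0 :=
  Polynomial.degree_eq_bot.trans toPoly_eq_zero

/-- The degree as a natural number (`0` for the zero polynomial). -/
def natDegree (p : DiffPoly δ) : ℕ := (toPoly p).natDegree

theorem coeff_sum_deriv (p : K[X]) (n : ℕ) :
    (p.sum fun i a => Polynomial.monomial i (δ a)).coeff n = δ (p.coeff n) := by
  simp only [Polynomial.sum_def, Polynomial.finsetSum_coeff, Polynomial.coeff_monomial,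
    Finset.sum_ite_eq']
  split_ifs with h
  · rfl
  · rw [Polynomial.notMem_support_iff.mp h, map_zero]

/-- The derivation `δ` applied to each coefficient. -/
def coeffDeriv (δ : Derivation F K K) : K[X] →ₗ[F] K[X] where
  toFun p := p.sum fun i a => Polynomial.monomial i (δ a)
  map_add' p q := by
    ext n
    simp only [coeff_sum_deriv, Polynomial.coeff_add, map_add]
  map_smul' c p := by
    ext n
    rw [coeff_sum_deriv, Polynomial.coeff_smul, Derivation.map_smul, RingHom.id_apply,
      Polynomial.coeff_smul, coeff_sum_deriv]

@[simp] theorem coeff_coeffDeriv (p : K[X]) (n : ℕ) :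
    (coeffDeriv δ p).coeff n = δ (p.coeff n) := coeff_sum_deriv p n

/-- Left multiplication by `t`: since `t a = a t + δ(a)`, it sends
`∑ aᵢ tⁱ` to `∑ aᵢ tⁱ⁺¹ + ∑ δ(aᵢ) tⁱ`. -/
def tMul (δ : Derivation F K K) : Module.End F K[X] :=
  LinearMap.mulLeft F (Polynomial.X : K[X]) + coeffDeriv δ

/-- Left multiplication by `∑ aᵢ tⁱ`: the additive map `∑ aᵢ • (left multiplication by t)ⁱ`. -/
def leftMul (δ : Derivation F K K) (p : K[X]) : Module.End F K[X] :=
  p.sum fun i a => a • tMul δ ^ i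

theorem tMul_apply (g : K[X]) : tMul δ g = Polynomial.X * g + coeffDeriv δ g := rfl

theorem leftMul_add (p q : K[X]) : leftMul δ (p + q) = leftMul δ p + leftMul δ q :=
  Polynomial.sum_add_index p q _ (by simp) (by simp [add_smul])

theorem leftMul_monomial (n : ℕ) (a : K) :
    leftMul δ (Polynomial.monomial n a) = a • tMul δ ^ n :=
  Polynomial.sum_monomial_index a _ (by simp)

theorem leftMul_zero : leftMul δ 0 = 0 := Polynomial.sum_zero_index _

theorem leftMul_smul (a : K) (p : K[X]) : leftMul δ (a • p) = a • leftMul δ p := by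
  induction p using Polynomial.induction_on' with
  | add p q hp hq => rw [smul_add, leftMul_add, hp, hq, leftMul_add, smul_add]
  | monomial n b =>
    rw [Polynomial.smul_monomial, leftMul_monomial, leftMul_monomial, smul_smul, smul_eq_mul]

theorem leftMul_smul' (c : F) (p : K[X]) : leftMul δ (c • p) = c • leftMul δ p := by
  rw [← algebraMap_smul K c p, leftMul_smul]
  ext1 g
  simp

theorem coeffDeriv_monomial (n : ℕ) (a : K) :
    coeffDeriv δ (Polynomial.monomial n a) = Polynomial.monomial n (δ a) := by
  ext k
  rw [coeff_coeffDeriv, Polynomial.coeff_monomial, Polynomial.coeff_monomial]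
  split_ifs <;> simp

theorem tMul_smul (a : K) (g : K[X]) : tMul δ (a • g) = a • tMul δ g + δ a • g := by
  ext n
  cases n with
  | zero => simp [tMul_apply, mul_comm (δ _)]
  | succ n => simp [tMul_apply, mul_comm (δ _)]; ring

theorem leftMul_tMul (h : K[X]) : leftMul δ (tMul δ h) = tMul δ * leftMul δ h := by
  induction h using Polynomial.induction_on' with
  | add p q hp hq => rw [map_add, leftMul_add, hp, hq, leftMul_add, mul_add]
  | monomial n a =>
    rw [tMul_apply, leftMul_add, Polynomial.X_mul_monomial, coeffDeriv_monomial,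
      leftMul_monomial, leftMul_monomial, leftMul_monomial]
    ext1 g
    simp [tMul_smul, pow_succ']

theorem leftMul_leftMul (p q : K[X]) :
    leftMul δ (leftMul δ p q) = leftMul δ p * leftMul δ q := by
  induction p using Polynomial.induction_on' with
  | add p p' hp hp' =>
    rw [leftMul_add, LinearMap.add_apply, leftMul_add, hp, hp', add_mul]
  | monomial n a =>
    rw [leftMul_monomial, LinearMap.smul_apply, leftMul_smul, smul_mul_assoc]
    congr 1
    induction n with
    | zero => simp
    | succ n ih => rw [pow_succ', Module.End.mul_apply, leftMul_tMul, ih, mul_assoc]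

theorem tMul_pow_one (n : ℕ) : (tMul δ ^ n) 1 = Polynomial.X ^ n := by
  induction n with
  | zero => simp
  | succ n ih =>
    have h : coeffDeriv δ ((Polynomial.X : K[X]) ^ n) = 0 := by
      rw [Polynomial.X_pow_eq_monomial, coeffDeriv_monomial]; simp
    rw [pow_succ', Module.End.mul_apply, ih, tMul_apply, h, add_zero, pow_succ']

theorem leftMul_one_right (p : K[X]) : leftMul δ p 1 = p := by
  induction p using Polynomial.induction_on' with
  | add p q hp hq => rw [leftMul_add, LinearMap.add_apply, hp, hq]
  | monomial n a =>
    rw [leftMul_monomial, LinearMap.smul_apply, tMul_pow_one, ← Polynomial.C_mul_X_pow_eq_monomial,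
      Polynomial.smul_eq_C_mul]

theorem leftMul_one_left : leftMul δ (1 : K[X]) = 1 := by
  rw [← Polynomial.monomial_zero_one, leftMul_monomial, one_smul, pow_zero]

instance : Mul (DiffPoly δ) := ⟨fun p q => toPoly.symm (leftMul δ (toPoly p) (toPoly q))⟩
instance : One (DiffPoly δ) := ⟨toPoly.symm 1⟩

theorem toPoly_mul (p q : DiffPoly δ) : toPoly (p * q) = leftMul δ (toPoly p) (toPoly q) := rfl
theorem toPoly_one : toPoly (1 : DiffPoly δ) = 1 := rfl

/-- The ring structure of `K[t;δ]`. -/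
instance : Ring (DiffPoly δ) where
  __ := (inferInstance : AddCommGroup (DiffPoly δ))
  left_distrib p q r := by ext1; simp [toPoly_mul]
  right_distrib p q r := by ext1; simp [toPoly_mul, leftMul_add]
  zero_mul p := by ext1; simp [toPoly_mul, leftMul_zero]
  mul_zero p := by ext1; simp [toPoly_mul]
  mul_assoc p q r := by ext1; simp [toPoly_mul, leftMul_leftMul]
  one_mul p := by ext1; simp [toPoly_mul, toPoly_one, leftMul_one_left]
  mul_one p := by ext1; simp [toPoly_mul, toPoly_one, leftMul_one_right]

instance : IsScalarTower K (DiffPoly δ) (DiffPoly δ) :=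
  ⟨fun a p q => by ext1; simp [toPoly_mul, leftMul_smul]⟩
instance : IsScalarTower F (DiffPoly δ) (DiffPoly δ) :=
  ⟨fun c p q => by ext1; simp [toPoly_mul, toPoly_smul, leftMul_smul']⟩
instance : SMulCommClass F (DiffPoly δ) (DiffPoly δ) :=
  ⟨fun c p q => by ext1; simp [toPoly_mul, toPoly_smul]⟩

/-- The constant polynomials. -/
def C : K →+* DiffPoly δ where
  toFun a := a • 1
  map_one' := one_smul _ _
  map_zero' := zero_smul _ _
  map_add' a b := add_smul _ _ _
  map_mul' a b := by rw [smul_mul_assoc, one_mul, smul_smul]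

/-- The variable `t`. -/
def t : DiffPoly δ := toPoly.symm Polynomial.X

/-- The defining relation `t a = a t + δ(a)`. -/
theorem t_mul_C (a : K) : (t : DiffPoly δ) * C a = C a * t + C (δ a) := by
  ext1
  have h : coeffDeriv δ (a • (1 : K[X])) = δ a • 1 := by
    rw [← Polynomial.monomial_zero_one, Polynomial.smul_monomial, coeffDeriv_monomial,
      Polynomial.smul_monomial]
    simp
  simp [toPoly_mul, t, C, toPoly_one, ← Polynomial.monomial_one_one_eq_X, leftMul_monomial,
    tMul_apply, h]

/-- Every differential polynomial is `∑ aᵢ tⁱ`, where the `aᵢ` are its coefficients. -/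
theorem eq_sum (p : DiffPoly δ) : p = (toPoly p).sum fun i a => C a * t ^ i := by
  have ht : ∀ i : ℕ, toPoly ((t : DiffPoly δ) ^ i) = Polynomial.X ^ i := by
    intro i
    induction i with
    | zero => rw [pow_zero, pow_zero, toPoly_one]
    | succ i ih =>
      have hX : leftMul δ (Polynomial.X : K[X]) = tMul δ := by
        rw [← Polynomial.monomial_one_one_eq_X, leftMul_monomial, one_smul, pow_one]
      rw [pow_succ', toPoly_mul, ih]
      change leftMul δ Polynomial.X _ = _
      rw [hX, ← tMul_pow_one (δ := δ) i, ← Module.End.mul_apply, ← pow_succ', tMul_pow_one]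
  ext1
  conv_lhs => rw [Polynomial.as_sum_support_C_mul_X_pow (toPoly p)]
  rw [Polynomial.sum_def, map_sum]
  refine Finset.sum_congr rfl fun i _ => ?_
  change _ = toPoly (((toPoly p).coeff i • (1 : DiffPoly δ)) * t ^ i)
  rw [smul_mul_assoc, one_mul, map_smul, ht, Polynomial.smul_eq_C_mul]

theorem coeff_tMul_pow (g : K[X]) (i k : ℕ) (hk : i + g.natDegree ≤ k) :
    ((tMul δ ^ i) g).coeff k = if k = i + g.natDegree then g.leadingCoeff else 0 := by
  induction i generalizing k with
  | zero =>
    rw [pow_zero, Module.End.one_apply]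
    split_ifs with h
    · rw [h, zero_add]; rfl
    · exact Polynomial.coeff_eq_zero_of_natDegree_lt (by omega)
  | succ i ih =>
    obtain ⟨k, rfl⟩ : ∃ l, k = l + 1 := ⟨k - 1, by omega⟩
    rw [pow_succ', Module.End.mul_apply, tMul_apply, Polynomial.coeff_add, Polynomial.coeff_X_mul,
      coeff_coeffDeriv, ih k (by omega), ih (k + 1) (by omega), if_neg (by omega : ¬ k + 1 = _),
      map_zero, add_zero]
    exact if_congr (by omega) rfl rfl

theorem coeff_leftMul (p g : K[X]) (k : ℕ) (hk : p.natDegree + g.natDegree ≤ k) :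
    (leftMul δ p g).coeff k =
      if k = p.natDegree + g.natDegree then p.leadingCoeff * g.leadingCoeff else 0 := by
  rw [leftMul, Polynomial.sum_def, LinearMap.sum_apply, Polynomial.finsetSum_coeff]
  have hterm : ∀ i ∈ p.support, ((p.coeff i • tMul δ ^ i) g).coeff k =
      if i = p.natDegree ∧ k = p.natDegree + g.natDegree
        then p.leadingCoeff * g.leadingCoeff else 0 := by
    intro i hi
    have hi' := Polynomial.le_natDegree_of_mem_supp i hi
    rw [LinearMap.smul_apply, Polynomial.coeff_smul, coeff_tMul_pow g i k (by omega), smul_eq_mul]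
    by_cases h1 : i = p.natDegree
    · subst h1
      split_ifs <;> first | rfl | omega | simp
    · rw [if_neg (by omega), if_neg (by tauto), mul_zero]
  rw [Finset.sum_congr rfl hterm]
  split_ifs with h
  · simp only [h, and_true, Finset.sum_ite_eq', Polynomial.mem_support_iff]
    by_cases hp : p = 0
    · simp [hp]
    · rw [if_pos (by simpa using hp)]
  · simp [h]

/-- `deg (p q) = deg p + deg q`. -/
theorem degree_mul (p q : DiffPoly δ) : degree (p * q) = degree p + degree q := by
  by_cases hp : p = 0
  · simp [hp, degree]
  by_cases hq : q = 0
  · simp [hq, degree]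
  have hp' : toPoly p ≠ 0 := by simpa using hp
  have hq' : toPoly q ≠ 0 := by simpa using hq
  rw [degree, degree, degree, toPoly_mul, Polynomial.degree_eq_natDegree hp',
    Polynomial.degree_eq_natDegree hq']
  apply le_antisymm
  · rw [← Nat.cast_add, Polynomial.degree_le_iff_coeff_zero]
    intro k hk
    have hk' : (toPoly p).natDegree + (toPoly q).natDegree < k := by exact_mod_cast hk
    rw [coeff_leftMul _ _ _ hk'.le, if_neg hk'.ne']
  · rw [← Nat.cast_add]
    apply Polynomial.le_degree_of_ne_zero
    rw [coeff_leftMul _ _ _ le_rfl, if_pos rfl]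
    exact mul_ne_zero (by simpa using hp') (by simpa using hq')

/-- Right division by a nonzero `f`: there are unique `q`, `r` with `g = q f + r` and
`deg r < deg f`. -/
theorem exists_divR (g f : DiffPoly δ) (hf : f ≠ 0) :
    ∃ r : DiffPoly δ, degree r < degree f ∧ ∃ q, g = q * f + r := by
  have hf' : toPoly f ≠ 0 := by simpa using hf
  have key : ∀ n : ℕ, ∀ g : DiffPoly δ, degree g < n →
      ∃ r : DiffPoly δ, degree r < degree f ∧ ∃ q, g = q * f + r := by
    intro n
    induction n with
    | zero =>
      intro g hg
      have hg0 : g = 0 := by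
        rw [← degree_eq_bot]
        exact Nat.WithBot.lt_zero_iff.mp (by simpa using hg)
      refine ⟨0, ?_, 0, by simp [hg0]⟩
      rw [degree_eq_bot.mpr rfl, bot_lt_iff_ne_bot]
      exact mt degree_eq_bot.mp hf
    | succ n ih =>
      intro g hg
      by_cases hlt : degree g < degree f
      · exact ⟨g, hlt, 0, by simp⟩
      rw [not_lt] at hlt
      have hg' : toPoly g ≠ 0 := by
        intro h
        rw [degree, degree, h, Polynomial.degree_zero, le_bot_iff, Polynomial.degree_eq_bot] at hlt
        exact hf' hlt
      have hle : (toPoly f).natDegree ≤ (toPoly g).natDegree := Polynomial.natDegree_le_natDegree hlt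
      have hgn : (toPoly g).natDegree ≤ n := by
        have h := hg
        rw [degree, Polynomial.degree_eq_natDegree hg', Nat.cast_lt] at h
        omega
      set c : K := (toPoly g).leadingCoeff / (toPoly f).leadingCoeff with hc
      have hlf : (toPoly f).leadingCoeff ≠ 0 := by simpa using hf'
      have hlg : (toPoly g).leadingCoeff ≠ 0 := by simpa using hg'
      have hc0 : c ≠ 0 := div_ne_zero hlg hlf
      set q₀ : DiffPoly δ :=
        toPoly.symm (Polynomial.monomial ((toPoly g).natDegree - (toPoly f).natDegree) c) with hq₀
      have hq1 : toPoly q₀ =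
          Polynomial.monomial ((toPoly g).natDegree - (toPoly f).natDegree) c := by simp [hq₀]
      have hqn : (toPoly q₀).natDegree = (toPoly g).natDegree - (toPoly f).natDegree := by
        rw [hq1, Polynomial.natDegree_monomial_eq _ hc0]
      have hql : (toPoly q₀).leadingCoeff = c := by rw [hq1, Polynomial.leadingCoeff_monomial]
      obtain ⟨r, hr, q, hq⟩ := ih (g - q₀ * f) (by
        rw [degree, Polynomial.degree_lt_iff_coeff_zero]
        intro k hk
        rw [map_sub, Polynomial.coeff_sub, toPoly_mul, coeff_leftMul _ _ _ (by omega), hqn, hql]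
        by_cases hkg : k = (toPoly g).natDegree
        · rw [if_pos (by omega), hc, div_mul_cancel₀ _ hlf, hkg]
          exact sub_self _
        · rw [if_neg (by omega), Polynomial.coeff_eq_zero_of_natDegree_lt (by omega), sub_zero])
      exact ⟨r, hr, q + q₀, by rw [add_mul, add_right_comm, ← hq, sub_add_cancel]⟩
  refine key ((natDegree g) + 1) g ?_
  exact lt_of_le_of_lt Polynomial.degree_le_natDegree (by exact_mod_cast Nat.lt_succ_self _)

theorem divR_unique {f q q' r r' : DiffPoly δ} (hr : degree r < degree f)
    (hr' : degree r' < degree f) (h : q * f + r = q' * f + r') : q = q' ∧ r = r' := by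
  have h1 : (q - q') * f = r' - r := by
    rw [sub_mul, sub_eq_sub_iff_add_eq_add, h, add_comm]
  have h2 : degree (r' - r) < degree f := by
    rw [degree, map_sub]
    exact lt_of_le_of_lt (Polynomial.degree_sub_le _ _) (max_lt hr' hr)
  have h3 : q - q' = 0 := by
    by_contra hne
    have hne' : toPoly (q - q') ≠ 0 := fun h0 => hne (toPoly_eq_zero.mp h0)
    rw [← h1, degree_mul] at h2
    refine absurd h2 (not_lt.mpr (le_add_of_nonneg_left ?_))
    exact Polynomial.zero_le_degree_iff.mpr hne'
  refine ⟨sub_eq_zero.mp h3, ?_⟩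
  rw [h3, zero_mul] at h1
  exact (sub_eq_zero.mp h1.symm).symm

open Classical in
/-- `g mod_r f`, the remainder of right division of `g` by `f` (with junk value `0` for `f = 0`). -/
def modR (g f : DiffPoly δ) : DiffPoly δ :=
  if hf : f ≠ 0 then (exists_divR g f hf).choose else 0

theorem modR_eq {g f q r : DiffPoly δ} (hr : degree r < degree f) (h : g = q * f + r) :
    modR g f = r := by
  have hf : f ≠ 0 := by rintro rfl; simp [degree] at hr
  rw [modR, dif_pos hf]
  obtain ⟨h1, q', h2⟩ := (exists_divR g f hf).choose_spec
  exact (divR_unique h1 hr (h2.symm.trans h)).2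

theorem modR_spec (g f : DiffPoly δ) (hf : f ≠ 0) :
    degree (modR g f) < degree f ∧ ∃ q, g = q * f + modR g f := by
  rw [modR, dif_pos hf]
  exact (exists_divR g f hf).choose_spec

theorem modR_zero_right (g : DiffPoly δ) : modR g 0 = 0 := by simp [modR]

theorem modR_add (g h f : DiffPoly δ) : modR (g + h) f = modR g f + modR h f := by
  by_cases hf : f = 0
  · simp [hf, modR_zero_right]
  obtain ⟨h1, q, h2⟩ := modR_spec g f hf
  obtain ⟨h3, q', h4⟩ := modR_spec h f hf
  refine modR_eq (q := q + q') ?_ ?_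
  · rw [degree, map_add]
    exact lt_of_le_of_lt (Polynomial.degree_add_le _ _) (max_lt h1 h3)
  · conv_lhs => rw [h2, h4]
    rw [add_mul]; abel

theorem modR_smul (a : K) (g f : DiffPoly δ) : modR (a • g) f = a • modR g f := by
  by_cases hf : f = 0
  · simp [hf, modR_zero_right]
  obtain ⟨h1, q, h2⟩ := modR_spec g f hf
  refine modR_eq (q := a • q) ?_ ?_
  · rw [degree, map_smul]
    exact lt_of_le_of_lt (Polynomial.degree_smul_le _ _) h1
  · conv_lhs => rw [h2]
    rw [smul_add, smul_mul_assoc]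

theorem modR_of_lt {g f : DiffPoly δ} (h : degree g < degree f) : modR g f = g :=
  modR_eq (q := 0) h (by simp)

variable (δ) in
/-- `R_m`, the differential polynomials of degree less than `m`. -/
def degreeLT (m : ℕ) : Submodule K (DiffPoly δ) where
  carrier := {g | degree g < m}
  zero_mem' := by simp [degree]
  add_mem' {a b} ha hb := by
    change degree _ < _
    rw [degree, map_add]
    exact lt_of_le_of_lt (Polynomial.degree_add_le _ _) (max_lt ha hb)
  smul_mem' a g hg := by
    change degree _ < _
    rw [degree, map_smul]
    exact lt_of_le_of_lt (Polynomial.degree_smul_le _ _) hg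

theorem modR_mem (g f : DiffPoly δ) : modR g f ∈ degreeLT δ f.natDegree := by
  by_cases hf : f = 0
  · rw [hf, modR_zero_right]; exact Submodule.zero_mem _
  · exact lt_of_lt_of_le (modR_spec g f hf).1 Polynomial.degree_le_natDegree

theorem modR_of_mem {g f : DiffPoly δ} (h : g ∈ degreeLT δ f.natDegree) : modR g f = g := by
  by_cases hf : f = 0
  · subst hf
    rw [modR_zero_right]
    have h0 : degree g < ((0 : ℕ) : WithBot ℕ) := h
    exact (degree_eq_bot.mp (Nat.WithBot.lt_zero_iff.mp (by simpa using h0))).symm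
  · refine modR_of_lt (lt_of_lt_of_eq h ?_)
    exact (Polynomial.degree_eq_natDegree (by simpa using hf)).symm

end DiffPoly

/-! ### Petit algebras -/

/-- The Petit algebra `S_f = K[t;δ]/K[t;δ]f`: the differential polynomials of degree less than
`deg f`, with multiplication `g ∘ h = g h mod_r f`. (It is the zero ring if `f` is constant.) -/
def PetitAlgebra {δ : Derivation F K K} (f : DiffPoly δ) : Type _ :=
  DiffPoly.degreeLT δ f.natDegree

namespace PetitAlgebra

variable {δ : Derivation F K K} {f : DiffPoly δ}

instance : AddCommGroup (PetitAlgebra f) :=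
  inferInstanceAs (AddCommGroup (DiffPoly.degreeLT δ f.natDegree))
instance : Module K (PetitAlgebra f) :=
  inferInstanceAs (Module K (DiffPoly.degreeLT δ f.natDegree))
instance : Module F (PetitAlgebra f) :=
  inferInstanceAs (Module F (DiffPoly.degreeLT δ f.natDegree))
instance : IsScalarTower F K (PetitAlgebra f) :=
  inferInstanceAs (IsScalarTower F K (DiffPoly.degreeLT δ f.natDegree))

/-- An element of `S_f` as a differential polynomial. -/
def val : PetitAlgebra f →ₗ[K] DiffPoly δ := (DiffPoly.degreeLT δ f.natDegree).subtype

theorem val_mem (x : PetitAlgebra f) : val x ∈ DiffPoly.degreeLT δ f.natDegree :=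
  x.property

@[ext] theorem ext {x y : PetitAlgebra f} (h : val x = val y) : x = y := Subtype.ext h

theorem val_smul (c : F) (x : PetitAlgebra f) : val (c • x) = c • val x := rfl

variable (f) in
/-- The class of `g` in `S_f`, that is, `g mod_r f`. -/
def mk (g : DiffPoly δ) : PetitAlgebra f := ⟨DiffPoly.modR g f, DiffPoly.modR_mem g f⟩

theorem val_mk (g : DiffPoly δ) : val (mk f g) = DiffPoly.modR g f := rfl

theorem mk_val (x : PetitAlgebra f) : mk f (val x) = x := ext (DiffPoly.modR_of_mem (val_mem x))

theorem mk_add (g h : DiffPoly δ) : mk f (g + h) = mk f g + mk f h :=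
  ext (DiffPoly.modR_add g h f)

theorem mk_smul (a : K) (g : DiffPoly δ) : mk f (a • g) = a • mk f g :=
  ext (DiffPoly.modR_smul a g f)

theorem mk_smul' (c : F) (g : DiffPoly δ) : mk f (c • g) = c • mk f g := by
  rw [← algebraMap_smul K c g, mk_smul, algebraMap_smul]

theorem mk_zero : mk f (0 : DiffPoly δ) = 0 := by
  have h := mk_smul (f := f) (0 : K) 0
  rwa [zero_smul, zero_smul] at h

instance : Mul (PetitAlgebra f) := ⟨fun x y => mk f (val x * val y)⟩
instance : One (PetitAlgebra f) := ⟨mk f 1⟩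

theorem mul_def (x y : PetitAlgebra f) : x * y = mk f (val x * val y) := rfl
theorem one_def : (1 : PetitAlgebra f) = mk f 1 := rfl

theorem one_mul_mul_one (x : PetitAlgebra f) : 1 * x = x ∧ x * 1 = x := by
  by_cases h : f.natDegree = 0
  · have hx : ∀ y : PetitAlgebra f, y = 0 := by
      intro y
      have h0 := val_mem y
      rw [h] at h0
      have h1 : DiffPoly.degree (val y) < ((0 : ℕ) : WithBot ℕ) := h0
      refine ext ((DiffPoly.degree_eq_bot.mp ?_).trans (map_zero val).symm)
      exact Nat.WithBot.lt_zero_iff.mp (by simpa using h1)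
    exact ⟨(hx _).trans (hx _).symm, (hx _).trans (hx _).symm⟩
  · have h1 : val (1 : PetitAlgebra f) = 1 := by
      refine DiffPoly.modR_of_mem ?_
      change DiffPoly.degree _ < _
      rw [DiffPoly.degree, DiffPoly.toPoly_one, Polynomial.degree_one]
      exact_mod_cast Nat.pos_of_ne_zero h
    rw [mul_def, mul_def, h1, one_mul, mul_one, mk_val]
    exact ⟨rfl, rfl⟩

/-- `S_f` is a unital nonassociative ring. -/
instance : NonAssocRing (PetitAlgebra f) where
  __ := (inferInstance : AddCommGroup (PetitAlgebra f))
  left_distrib x y z := by simp only [mul_def, map_add, mul_add, mk_add]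
  right_distrib x y z := by simp only [mul_def, map_add, add_mul, mk_add]
  zero_mul x := by simp only [mul_def, map_zero, zero_mul, mk_zero]
  mul_zero x := by simp only [mul_def, map_zero, mul_zero, mk_zero]
  one_mul x := (one_mul_mul_one x).1
  mul_one x := (one_mul_mul_one x).2

instance : IsScalarTower K (PetitAlgebra f) (PetitAlgebra f) :=
  ⟨fun a x y => by simp only [smul_eq_mul, mul_def, map_smul, smul_mul_assoc, mk_smul]⟩

/-! The next two instances say that `S_f` is an algebra over `F`. -/

instance : IsScalarTower F (PetitAlgebra f) (PetitAlgebra f) :=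
  ⟨fun c x y => by simp only [smul_eq_mul, mul_def, val_smul, smul_mul_assoc, mk_smul']⟩
instance : SMulCommClass F (PetitAlgebra f) (PetitAlgebra f) :=
  ⟨fun c x y => by simp only [smul_eq_mul, mul_def, val_smul, mul_smul_comm, mk_smul']⟩

variable (f) in
/-- The field `K` inside `S_f`, as the constant polynomials. -/
def const : K →+* PetitAlgebra f where
  toFun a := mk f (DiffPoly.C a)
  map_one' := by rw [map_one, one_def]
  map_zero' := by rw [map_zero, mk_zero]
  map_add' a b := by rw [map_add, mk_add]
  map_mul' a b := by
    have h : ∀ c : K, mk f (DiffPoly.C c) = c • (1 : PetitAlgebra f) := fun c => mk_smul c 1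
    rw [h, h, h, smul_mul_assoc, one_mul, smul_smul]

end PetitAlgebra

end DifferentialPolynomials

/-! ### Nuclei of a nonassociative ring -/

section Nuclei

variable (A : Type*) [NonAssocRing A]

/-- The left nucleus `{x | [x, A, A] = 0}`. -/
def leftNucleus : Subring A where
  carrier := {x | ∀ y z, associator x y z = 0}
  zero_mem' y z := by simp [associator_apply]
  one_mem' y z := by simp [associator_apply]
  add_mem' {a b} ha hb y z := by
    simp only [Set.mem_ofPred_eq, associator_apply, sub_eq_zero] at *
    simp only [add_mul, ha, hb]
  neg_mem' {a} ha y z := by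
    simp only [Set.mem_ofPred_eq, associator_apply, sub_eq_zero] at *
    simp only [neg_mul, ha]
  mul_mem' {a b} ha hb y z := by
    simp only [Set.mem_ofPred_eq, associator_apply, sub_eq_zero] at *
    rw [ha, ha, hb, ha]

/-- The middle nucleus `{x | [A, x, A] = 0}`. -/
def middleNucleus : Subring A where
  carrier := {x | ∀ y z, associator y x z = 0}
  zero_mem' y z := by simp [associator_apply]
  one_mem' y z := by simp [associator_apply]
  add_mem' {a b} ha hb y z := by
    simp only [Set.mem_ofPred_eq, associator_apply, sub_eq_zero] at *
    simp only [add_mul, mul_add, ha, hb]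
  neg_mem' {a} ha y z := by
    simp only [Set.mem_ofPred_eq, associator_apply, sub_eq_zero] at *
    simp only [neg_mul, mul_neg, ha]
  mul_mem' {a b} ha hb y z := by
    simp only [Set.mem_ofPred_eq, associator_apply, sub_eq_zero] at *
    rw [← ha, hb, ha, hb]

/-- The right nucleus `{x | [A, A, x] = 0}`. -/
def rightNucleus : Subring A where
  carrier := {x | ∀ y z, associator y z x = 0}
  zero_mem' y z := by simp [associator_apply]
  one_mem' y z := by simp [associator_apply]
  add_mem' {a b} ha hb y z := by
    simp only [Set.mem_ofPred_eq, associator_apply, sub_eq_zero] at *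
    simp only [mul_add, ha, hb]
  neg_mem' {a} ha y z := by
    simp only [Set.mem_ofPred_eq, associator_apply, sub_eq_zero] at *
    simp only [mul_neg, ha]
  mul_mem' {a b} ha hb y z := by
    simp only [Set.mem_ofPred_eq, associator_apply, sub_eq_zero] at *
    rw [← hb, ha, hb, hb]

variable {A}

/-- The right nucleus is an associative ring. -/
instance rightNucleus.instRing : Ring (rightNucleus A) where
  __ := (inferInstance : NonAssocRing (rightNucleus A))
  mul_assoc x y z := Subtype.ext (sub_eq_zero.mp (z.2 x y))

variable {F : Type*} [CommRing F] [Module F A] [SMulCommClass F A A]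

theorem smul_mem_rightNucleus (c : F) {x : A} (hx : x ∈ rightNucleus A) :
    c • x ∈ rightNucleus A := by
  intro y z
  have h := sub_eq_zero.mp (hx y z)
  rw [associator_apply, sub_eq_zero, mul_smul_comm, mul_smul_comm, mul_smul_comm, h]

variable [IsScalarTower F A A]

/-- The right nucleus of an `F`-algebra is an associative `F`-algebra. -/
instance rightNucleus.instAlgebra : Algebra F (rightNucleus A) where
  smul c x := ⟨c • (x : A), smul_mem_rightNucleus c x.2⟩
  algebraMap :=
    { toFun c := ⟨c • (1 : A), smul_mem_rightNucleus c (one_mem _)⟩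
      map_one' := Subtype.ext (one_smul _ _)
      map_zero' := Subtype.ext (zero_smul _ _)
      map_add' c d := Subtype.ext (add_smul _ _ _)
      map_mul' c d := Subtype.ext (by
        change (c * d) • (1 : A) = (c • (1 : A)) * (d • (1 : A))
        rw [smul_mul_assoc, one_mul, smul_smul]) }
  commutes' c x := Subtype.ext (by
    change (c • (1 : A)) * (x : A) = (x : A) * (c • (1 : A))
    rw [smul_mul_assoc, mul_smul_comm, one_mul, mul_one])
  smul_def' c x := Subtype.ext (by
    change c • (x : A) = (c • (1 : A)) * (x : A)
    rw [smul_mul_assoc, one_mul])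

theorem rightNucleus.coe_smul (c : F) (x : rightNucleus A) : ((c • x : rightNucleus A) : A) = c • (x : A) :=
  rfl

end Nuclei

end

/-! Let `δ` be a derivation of K with constants F. Then `δ ⊗ 1` on K ⊗ B has kernel B. Transported
to Mat_m(K), it differs from entrywise differentiation by a K-linear derivation, which is inner. So
B becomes the set of matrices X with δX = PX − XP for a fixed P (`exists_horizontal_iff`). These are
exactly the X whose right multiplication commutes with D(w) = δw + wP on row vectors; thus B is, up
to reversing products, the endomorphism ring of the differential module W = K^m. In characteristic 0
this module has a cyclic vector w (`DiffPoly.exists_cyclic`), whose annihilator is K[t;δ]f with deg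
f = m, and evaluation at w identifies S_f with W.

Write yz = qf + y∘z. Evaluated at w, the associator [y,z,x] is −q f (xw). Hence x lies in the right
nucleus iff f kills xw, that is, iff w ↦ xw extends to an endomorphism of W; this makes the right
nucleus B. An element of positive degree in the left or middle nucleus would allow q to be a nonzero
constant for every x, so the right nucleus would be all of S_f. Then S_f ≅ B would be
finite-dimensional, although it contains the infinite extension K/F. Automorphisms preserve the
right nucleus, and Skolem–Noether makes them inner there.

It remains to find `δ`. Derivations can be prescribed on a transcendence basis. If the basis is
infinite, `δ` shifts the variables along copies of ℕ; if it is finite, δz = 1 and δx_j = z^(j+1)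
x_j, so that distinct monomials in the x_j have distinct weights in F[z]. -/

noncomputable section

/-! ### Derivations and transcendence bases; infinite transcendence degree. -/

section DifferentialBasis

open KaehlerDifferential

variable {F K : Type*} [Field F] [CharZero F] [Field K] [Algebra F K]

open scoped IntermediateField.algebraAdjoinAdjoin in
/-- In characteristic zero, a field is formally étale over the polynomial ring on a transcendence
basis. -/
theorem IsTranscendenceBasis.formallyEtale_aeval {ι : Type*} {x : ι → K}
    (hx : IsTranscendenceBasis F x) :
    letI := (MvPolynomial.aeval (R := F) x).toAlgebra
    Algebra.FormallyEtale (MvPolynomial ι F) K := by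
  let := (MvPolynomial.aeval (R := F) x).toAlgebra
  -- Three formally étale layers: `A` is a copy of the polynomial ring, `L` is its fraction field,
  -- and `K` is algebraic over `L`, hence separable in characteristic 0.
  let A := Algebra.adjoin F (Set.range x)
  let L := IntermediateField.adjoin F (Set.range x)
  let : Algebra (MvPolynomial ι F) A := (hx.1.aevalEquiv : MvPolynomial ι F →+* A).toAlgebra
  have : IsScalarTower (MvPolynomial ι F) A K := .of_algebraMap_eq fun p => by
    change _ = (hx.1.aevalEquiv p : K)
    rw [hx.1.aevalEquiv_apply_coe]
    rfl
  have : Algebra.FormallyEtale (MvPolynomial ι F) A :=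
    .of_equiv { hx.1.aevalEquiv with commutes' := fun _ => rfl }
  have : Algebra.FormallyEtale A L := .of_isLocalization (nonZeroDivisors _)
  have : Algebra.IsAlgebraic L K := hx.isAlgebraic_field
  have : Algebra.FormallyEtale L K := .of_isSeparable L K
  have : Algebra.FormallyEtale A K := .comp _ L _
  exact .comp _ A _

/-- The differentials of a transcendence basis form a basis of the Kähler differentials. -/
theorem IsTranscendenceBasis.exists_basis_kaehlerDifferential {ι : Type*} {x : ι → K}
    (hx : IsTranscendenceBasis F x) :
    ∃ b : Module.Basis ι K Ω[K⁄F], ∀ i, b i = D F K (x i) := by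
  let := (MvPolynomial.aeval (R := F) x).toAlgebra
  have : IsScalarTower F (MvPolynomial ι F) K := .of_algebraMap_eq fun c => by
    change _ = MvPolynomial.aeval x (MvPolynomial.C c)
    rw [MvPolynomial.aeval_C]
  have : Algebra.FormallyEtale (MvPolynomial ι F) K := hx.formallyEtale_aeval
  refine ⟨((mvPolynomialBasis F ι).baseChange K).map
    (tensorKaehlerEquivOfFormallyEtale F (MvPolynomial ι F) K), fun i => ?_⟩
  rw [Module.Basis.map_apply, Module.Basis.baseChange_apply, mvPolynomialBasis_apply,
    tensorKaehlerEquivOfFormallyEtale_apply, mapBaseChange_tmul, one_smul, map_D]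
  change D F K (MvPolynomial.aeval x (MvPolynomial.X i)) = _
  rw [MvPolynomial.aeval_X]

/-- A transcendental element extends to a transcendence basis, so its differential is a member of a
basis of `Ω[K⁄F]`. -/
theorem kaehlerDifferential_D_ne_zero {c : K} (hc : Transcendental F c) : D F K c ≠ 0 := by
  have h1 : AlgebraicIndepOn F id ({c} : Set K) := by
    have : AlgebraicIndependent F (fun i : ({c} : Set K) => (i : K)) :=
      (algebraicIndependent_unique_type_iff (ι := ({c} : Set K))).mpr hc
    exact this
  obtain ⟨t, ht, hb⟩ := exists_isTranscendenceBasis_superset h1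
  obtain ⟨b, hb'⟩ := hb.exists_basis_kaehlerDifferential
  rw [← hb' ⟨c, ht rfl⟩]
  exact b.ne_zero _

/-- There is a derivation with prescribed values on a transcendence basis. -/
theorem IsTranscendenceBasis.exists_derivation {ι : Type*} {x : ι → K}
    (hx : IsTranscendenceBasis F x) (v : ι → K) :
    ∃ δ : Derivation F K K, ∀ i, δ (x i) = v i := by
  obtain ⟨b, hb⟩ := hx.exists_basis_kaehlerDifferential
  refine ⟨(b.constr K v).compDer (D F K), fun i => ?_⟩
  change b.constr K v (D F K (x i)) = _
  rw [← hb, Module.Basis.constr_basis]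

theorem IsTranscendenceBasis.derivation_ext {ι : Type*} {x : ι → K}
    (hx : IsTranscendenceBasis F x) {δ δ' : Derivation F K K} (h : ∀ i, δ (x i) = δ' (x i)) :
    δ = δ' := by
  obtain ⟨b, hb⟩ := hx.exists_basis_kaehlerDifferential
  rw [← Derivation.liftKaehlerDifferential_comp δ, ← Derivation.liftKaehlerDifferential_comp δ']
  refine congrArg (fun l : Ω[K⁄F] →ₗ[K] K => l.compDer (D F K)) (b.ext fun i => ?_)
  rw [hb, Derivation.liftKaehlerDifferential_comp_D, Derivation.liftKaehlerDifferential_comp_D, h]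

/-- A system of partial derivatives with respect to a transcendence basis. -/
theorem IsTranscendenceBasis.exists_partial {ι : Type*} [DecidableEq ι] {x : ι → K}
    (hx : IsTranscendenceBasis F x) :
    ∃ d : ι → Derivation F K K, (∀ i j, d i (x j) = if i = j then 1 else 0) ∧
      (∀ c, {i | d i c ≠ 0}.Finite) ∧ (∀ c, (∀ i, d i c = 0) → IsAlgebraic F c) ∧
      ∀ (δ : Derivation F K K) c, ∃ s : Finset ι, (∀ i, i ∉ s → d i c = 0) ∧
        δ c = ∑ i ∈ s, d i c * δ (x i) := by
  obtain ⟨b, hb⟩ := hx.exists_basis_kaehlerDifferential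
  refine ⟨fun i => (b.coord i).compDer (D F K), fun i j => ?_, fun c => ?_, fun c hc => ?_,
    fun δ c => ⟨(b.repr (D F K c)).support, fun i hi => Finsupp.notMem_support_iff.mp hi, ?_⟩⟩
  · change b.repr (D F K (x j)) i = _
    rw [← hb, b.repr_self, Finsupp.single_apply]
    exact if_congr eq_comm rfl rfl
  · refine (b.repr (D F K c)).hasFiniteSupport.subset fun i hi => hi
  · by_contra h
    refine kaehlerDifferential_D_ne_zero h (b.repr.injective ?_)
    rw [map_zero]
    exact Finsupp.ext hc
  · rw [← Derivation.liftKaehlerDifferential_comp_D δ c]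
    conv_lhs => rw [← b.linearCombination_repr (D F K c)]
    rw [Finsupp.linearCombination_apply, Finsupp.sum, map_sum]
    refine Finset.sum_congr rfl fun i _ => ?_
    rw [map_smul, hb, Derivation.liftKaehlerDifferential_comp_D, smul_eq_mul]
    rfl

/-- A field extension of infinite transcendence degree in characteristic zero has a derivation
whose constants are algebraic. -/
theorem exists_derivation_of_infinite {κ : Type*} {x : κ × ℕ → K}
    (hx : IsTranscendenceBasis F x) :
    ∃ δ : Derivation F K K, ∀ c, δ c = 0 → IsAlgebraic F c := by
  classical
  obtain ⟨d, hd, hfin, halg, hsum⟩ := hx.exists_partial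
  -- The shift along each copy of ℕ.
  obtain ⟨δ, hδ⟩ := hx.exists_derivation fun p => x (p.1, p.2 + 1)
  -- The commutator of two partial derivatives is a derivation vanishing on the transcendence basis.
  have hcomm : ∀ i j c, d i (d j c) = d j (d i c) := fun i j c => by
    have h : ⁅d i, d j⁆ = 0 := hx.derivation_ext fun k => by
      rw [Derivation.commutator_apply, hd, hd, Derivation.zero_apply]
      split_ifs <;> simp
    have h' := congrArg (fun e : Derivation F K K => e c) h
    rwa [Derivation.commutator_apply, Derivation.zero_apply, sub_eq_zero] at h'
  refine ⟨δ, fun c hc => halg c ?_⟩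
  by_contra! hne
  -- Take a variable of largest level n on which c depends. Since c does not depend on (k, n+1),
  -- applying `d (k, n + 1)` to δc = ∑ (d i c) · δ(x i) leaves only `d (k, n) c`, which must then
  -- vanish.
  obtain ⟨⟨k, n⟩, hkn, hmax⟩ := (hfin c).exists_maximalFor (fun p : κ × ℕ => p.2) _ hne
  have hz : d (k, n + 1) c = 0 := by
    by_contra h
    have h1 : n + 1 ≤ n := hmax h (Nat.le_succ n)
    omega
  obtain ⟨s, hs, hδc⟩ := hsum δ c
  refine hkn ?_
  have h := congrArg (d (k, n + 1)) hδc
  rw [hc, map_zero, map_sum] at h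
  rw [h]
  have hks : (k, n) ∈ s := by
    by_contra h'
    exact hkn (hs _ h')
  rw [Finset.sum_eq_single (k, n)]
  · simp [hδ, hd, hcomm, hz]
  · rintro ⟨k', n'⟩ - hne'
    rw [Derivation.leibniz, hcomm, hz, map_zero, smul_zero, add_zero, hδ, hd, if_neg, smul_zero]
    rintro h'
    apply hne'
    simp only [Prod.mk.injEq, add_left_inj] at h'
    rw [h'.1, h'.2]
  · exact fun h' => absurd hks h'

end DifferentialBasis

/-! ### Finite transcendence degree, and a derivation with constants F. -/

section FiniteTranscendenceDegree

variable {F : Type*} [Field F]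

/-- The polynomial `∑ αⱼ Xʲ⁺¹` attached to an exponent vector `α`. -/
def exponentPoly (F : Type*) [Field F] {n : ℕ} (α : Fin n →₀ ℕ) : F[X] :=
  ∑ j, (α j : F[X]) * Polynomial.X ^ (j.val + 1)

theorem exponentPoly_add {n : ℕ} (α β : Fin n →₀ ℕ) :
    exponentPoly F (α + β) = exponentPoly F α + exponentPoly F β := by
  simp [exponentPoly, add_mul, Finset.sum_add_distrib]

variable {K : Type*} [Field K] [Algebra F K]

/-- Constants of an algebraic extension are algebraic over the constants of the base. -/
theorem Derivation.isAlgebraic_of_eq_zero (δ : Derivation F K K) (L : IntermediateField F K)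
    [Algebra.IsAlgebraic L K] (hL : ∀ a ∈ L, δ a ∈ L) (hc : ∀ a ∈ L, δ a = 0 → IsAlgebraic F a)
    {c : K} (h : δ c = 0) : IsAlgebraic F c := by
  have hint : IsIntegral L c := (Algebra.IsAlgebraic.isAlgebraic c).isIntegral
  set p := minpoly L c with hp
  -- The minimal polynomial with its coefficients differentiated. Its degree drops because the
  -- leading coefficient is 1.
  let q : L[X] := ∑ i ∈ Finset.range p.natDegree,
    Polynomial.monomial i ⟨δ (p.coeff i), hL _ (p.coeff i).2⟩
  have hqc : ∀ i, (q.coeff i : K) = δ (p.coeff i) := by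
    intro i
    have : q.coeff i = if i < p.natDegree then ⟨δ (p.coeff i), hL _ (p.coeff i).2⟩ else 0 := by
      simp [q, Polynomial.finsetSum_coeff, Polynomial.coeff_monomial]
    rw [this]
    split_ifs with hi
    · rfl
    · rcases (not_lt.mp hi).eq_or_lt with h' | h'
      · rw [← h', hp, (minpoly.monic hint).coeff_natDegree]; simp
      · rw [Polynomial.coeff_eq_zero_of_natDegree_lt h']; simp
  have hq : q.degree < p.degree := by
    rw [Polynomial.degree_eq_natDegree (minpoly.ne_zero hint), Polynomial.degree_lt_iff_coeff_zero]
    intro k hk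
    simp only [q, Polynomial.finsetSum_coeff, Polynomial.coeff_monomial]
    exact Finset.sum_eq_zero fun i hi => if_neg fun h' => by
      rw [Finset.mem_range, h'] at hi
      exact absurd hi (not_lt.mpr hk)
  -- As δc = 0, differentiating p(c) = 0 gives q(c) = 0, and minimality forces q = 0. So the
  -- coefficients of p are constants of `L`, hence algebraic over F.
  have hq0 : q = 0 := by
    by_contra hne
    refine absurd (minpoly.degree_le_of_ne_zero L c hne ?_) (not_le.mpr hq)
    have h0 := congrArg δ (minpoly.aeval L c)
    rw [map_zero, ← hp, Polynomial.aeval_eq_sum_range, map_sum] at h0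
    rw [Polynomial.aeval_eq_sum_range' (n := p.natDegree + 1)
      (Nat.lt_succ_of_le (Polynomial.natDegree_le_natDegree hq.le)), ← h0]
    refine Finset.sum_congr rfl fun i _ => ?_
    rw [Algebra.smul_def, Algebra.smul_def, Derivation.leibniz, Derivation.leibniz_pow, h]
    change (q.coeff i : K) * _ = _ + _ * δ (p.coeff i : K)
    rw [hqc]
    simp [mul_comm]
  let E := algebraicClosure F K
  have hmem : ∀ i, (p.coeff i : K) ∈ E := fun i => by
    refine (mem_algebraicClosure_iff).mpr (hc _ (p.coeff i).2 ?_)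
    rw [← hqc, hq0]; simp
  have hpm : p.map (algebraMap L K) ∈ Polynomial.lifts (algebraMap E K) := by
    rw [Polynomial.lifts_iff_coeff_lifts]
    intro i
    rw [Polynomial.coeff_map]
    exact ⟨⟨_, hmem i⟩, rfl⟩
  obtain ⟨r, hr⟩ := (Polynomial.mem_lifts _).mp hpm
  have hr0 : r ≠ 0 := by
    rintro rfl
    rw [Polynomial.map_zero, eq_comm, Polynomial.map_eq_zero] at hr
    exact minpoly.ne_zero hint hr
  have hE : IsAlgebraic E c := ⟨r, hr0, by
    rw [← Polynomial.eval_map_algebraMap, hr, Polynomial.eval_map_algebraMap, minpoly.aeval]⟩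
  exact hE.restrictScalars F

variable [CharZero F]

/-- In characteristic 0 the coefficient of X^(j+1) recovers α_j. Distinct monomials therefore have
distinct weights. -/
theorem exponentPoly_injective {n : ℕ} :
    Function.Injective (exponentPoly F : (Fin n →₀ ℕ) → F[X]) := by
  have key : ∀ (α : Fin n →₀ ℕ) j, (exponentPoly F α).coeff (j.val + 1) = α j := fun α j => by
    rw [exponentPoly, Polynomial.finsetSum_coeff, Finset.sum_eq_single j]
    · rw [← Polynomial.C_eq_natCast, Polynomial.coeff_C_mul, Polynomial.coeff_X_pow_self, mul_one]
    · intro k _ hk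
      rw [← Polynomial.C_eq_natCast, Polynomial.coeff_C_mul, Polynomial.coeff_X_pow, if_neg,
        mul_zero]
      exact fun h => hk (Fin.ext (by omega))
    · simp
  intro α β h
  ext j
  have := congrArg (fun p => p.coeff (j.val + 1)) h
  simp only [key] at this
  exact_mod_cast this

/-- The hypothesis reads p'/p + b = q'/q + c. Logarithmic derivatives have negative degree at
infinity, so the polynomial b − c is zero; the leading terms deg p / X and deg q / X then agree. -/
theorem eq_and_natDegree_eq_of_logDeriv_eq {p q b c : F[X]} (hp : p ≠ 0) (hq : q ≠ 0)
    (h : (p.derivative + b * p) * q = p * (q.derivative + c * q)) :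
    b = c ∧ p.natDegree = q.natDegree := by
  have h1 : (b - c) * (p * q) = p * q.derivative - p.derivative * q := by linear_combination h
  have hpq : p * q ≠ 0 := mul_ne_zero hp hq
  have h2 : (p * q.derivative - p.derivative * q).degree < (p * q).degree := by
    refine lt_of_le_of_lt (Polynomial.degree_sub_le _ _) (max_lt ?_ ?_)
    · rw [Polynomial.degree_mul, Polynomial.degree_mul]
      exact WithBot.add_lt_add_left (Polynomial.degree_eq_bot.not.mpr hp)
        (Polynomial.degree_derivative_lt hq)
    · rw [Polynomial.degree_mul, Polynomial.degree_mul]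
      exact WithBot.add_lt_add_right (Polynomial.degree_eq_bot.not.mpr hq)
        (Polynomial.degree_derivative_lt hp)
  have hbc : b = c := by
    by_contra hne
    rw [← h1, Polynomial.degree_mul] at h2
    exact absurd h2 (not_lt.mpr (le_add_of_nonneg_left
      (Polynomial.zero_le_degree_iff.mpr (sub_ne_zero.mpr hne))))
  refine ⟨hbc, ?_⟩
  rw [hbc, sub_self, zero_mul] at h1
  by_cases hd : p.natDegree + q.natDegree = 0
  · omega
  obtain ⟨N, hN⟩ := Nat.exists_eq_succ_of_ne_zero hd
  -- The factor X puts the comparison in degree deg p + deg q, where the two products contribute deg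
  -- q and deg p times the same nonzero scalar.
  have hco := congrArg (fun r => (Polynomial.X * r).coeff (p.natDegree + q.natDegree)) h1.symm
  have e1 : (Polynomial.X * (p * q.derivative)).coeff (p.natDegree + q.natDegree) =
      q.natDegree * (p.leadingCoeff * q.leadingCoeff) := by
    have : (Polynomial.X * q.derivative).natDegree ≤ q.natDegree := by
      by_cases h0 : q.natDegree = 0
      · rw [Polynomial.derivative_of_natDegree_zero h0]; simp
      · refine Polynomial.natDegree_mul_le.trans ?_
        have := Polynomial.natDegree_derivative_le q
        rw [Polynomial.natDegree_X]; omega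
    rw [show Polynomial.X * (p * q.derivative) = p * (Polynomial.X * q.derivative) by ring,
      Polynomial.coeff_mul_add_eq_of_natDegree_le le_rfl this]
    cases hm : q.natDegree with
    | zero => rw [Polynomial.derivative_of_natDegree_zero hm]; simp
    | succ k =>
      rw [Polynomial.coeff_X_mul, Polynomial.coeff_derivative, ← hm]
      rw [Polynomial.coeff_natDegree, Polynomial.coeff_natDegree, hm]; push_cast; ring
  have e2 : (Polynomial.X * (p.derivative * q)).coeff (p.natDegree + q.natDegree) =
      p.natDegree * (p.leadingCoeff * q.leadingCoeff) := by
    have : (Polynomial.X * p.derivative).natDegree ≤ p.natDegree := by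
      by_cases h0 : p.natDegree = 0
      · rw [Polynomial.derivative_of_natDegree_zero h0]; simp
      · refine Polynomial.natDegree_mul_le.trans ?_
        have := Polynomial.natDegree_derivative_le p
        rw [Polynomial.natDegree_X]; omega
    rw [← mul_assoc, Polynomial.coeff_mul_add_eq_of_natDegree_le this le_rfl]
    cases hm : p.natDegree with
    | zero => rw [Polynomial.derivative_of_natDegree_zero hm]; simp
    | succ k =>
      rw [Polynomial.coeff_X_mul, Polynomial.coeff_derivative, ← hm]
      rw [Polynomial.coeff_natDegree, Polynomial.coeff_natDegree, hm]; push_cast; ring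
  simp only [mul_zero, mul_sub, Polynomial.coeff_sub, e1, e2, Polynomial.coeff_zero] at hco
  rw [← sub_mul, mul_eq_zero, or_iff_left (mul_ne_zero (by simpa using hp) (by simpa using hq)),
    sub_eq_zero] at hco
  exact_mod_cast hco.symm

/-- The rational functions killed by a diagonal operator with weights `exponentPoly` are
constants. -/
theorem MvPolynomial.exists_eq_smul_of_diagonal {n : ℕ}
    (T : MvPolynomial (Fin n) F[X] →ₗ[F] MvPolynomial (Fin n) F[X])
    (hT : ∀ p α, (T p).coeff α = (p.coeff α).derivative + exponentPoly F α * p.coeff α)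
    {p q : MvPolynomial (Fin n) F[X]} (hq : q ≠ 0) (h : T p * q = p * T q) :
    ∃ c : F, p = c • q := by
  let o : MonomialOrder (Fin n) := MonomialOrder.lex
  have hle : ∀ r, o.toSyn (o.degree (T r)) ≤ o.toSyn (o.degree r) := fun r => by
    rw [o.degree_le_iff]
    intro α hα
    refine o.le_degree ?_
    rw [MvPolynomial.mem_support_iff] at hα ⊢
    intro h0
    rw [hT, h0] at hα
    simp at hα
  -- `T` is diagonal on monomials and does not raise the degree. Comparing coefficients at the sum
  -- of the leading exponents yields the logarithmic derivative equation for the leading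
  -- coefficients, with the weights as b and c.
  have key : ∀ r, r ≠ 0 → T r * q = r * T q → o.degree r = o.degree q ∧
      (o.leadingCoeff r).natDegree = (o.leadingCoeff q).natDegree := by
    intro r hr hrq
    have hc := congrArg (MvPolynomial.coeff (o.degree r + o.degree q)) hrq
    rw [o.coeff_mul_of_add_of_degree_le (hle r) le_rfl,
      o.coeff_mul_of_add_of_degree_le le_rfl (hle q), hT, hT] at hc
    obtain ⟨h1, h2⟩ := eq_and_natDegree_eq_of_logDeriv_eq (o.leadingCoeff_ne_zero_iff.mpr hr)
      (o.leadingCoeff_ne_zero_iff.mpr hq) hc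
    exact ⟨exponentPoly_injective h1, h2⟩
  by_cases hp : p = 0
  · exact ⟨0, by rw [hp, zero_smul]⟩
  obtain ⟨h1, h2⟩ := key p hp h
  have hlq : (o.leadingCoeff q).leadingCoeff ≠ 0 := by
    rw [Polynomial.leadingCoeff_ne_zero, o.leadingCoeff_ne_zero_iff]; exact hq
  have hlp : (o.leadingCoeff p).leadingCoeff ≠ 0 := by
    rw [Polynomial.leadingCoeff_ne_zero, o.leadingCoeff_ne_zero_iff]; exact hp
  -- This c cancels the top scalar. If p − c q were nonzero, `key` would give it the same leading
  -- exponent and the same degree of leading coefficient as q, at which its coefficient has just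
  -- been made zero.
  set c := (o.leadingCoeff p).leadingCoeff / (o.leadingCoeff q).leadingCoeff with hc
  refine ⟨c, sub_eq_zero.mp ?_⟩
  by_contra hr
  obtain ⟨h3, h4⟩ := key (p - c • q) hr (by
    rw [map_sub, map_smul, sub_mul, sub_mul, h, smul_mul_assoc, smul_mul_assoc, mul_comm q])
  have h5 : o.leadingCoeff (p - c • q) = o.leadingCoeff p - c • o.leadingCoeff q := by
    rw [MonomialOrder.leadingCoeff, h3, MvPolynomial.coeff_sub, MvPolynomial.coeff_smul]
    rw [MonomialOrder.leadingCoeff, h1, MonomialOrder.leadingCoeff]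
  have h6 := o.leadingCoeff_ne_zero_iff.mpr hr
  refine h6 (Polynomial.leadingCoeff_eq_zero.mp ?_)
  rw [Polynomial.leadingCoeff, h4, h5, Polynomial.coeff_sub, Polynomial.coeff_smul]
  conv_lhs => rw [← h2, Polynomial.coeff_natDegree, h2, Polynomial.coeff_natDegree]
  rw [hc, smul_eq_mul, div_mul_cancel₀ _ hlq, sub_self]

/-- A field extension of finite nonzero transcendence degree in characteristic zero has a derivation
whose constants are algebraic. -/
theorem exists_derivation_of_finite {n : ℕ} {x : Option (Fin n) → K}
    (hx : IsTranscendenceBasis F x) :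
    ∃ δ : Derivation F K K, ∀ c, δ c = 0 → IsAlgebraic F c := by
  -- With z = `x none`: δz = 1 and δx_j = z^(j+1) x_j, so the monomial x^α is an eigenvector with
  -- eigenvalue `exponentPoly F α` evaluated at z.
  obtain ⟨δ, hδ⟩ := hx.exists_derivation
    fun i => i.elim 1 fun j => x none ^ (j.val + 1) * x (some j)
  let ψ : MvPolynomial (Fin n) F[X] →ₐ[F] K :=
    MvPolynomial.aevalTower (Polynomial.aeval (x none)) fun j => x (some j)
  have hψ : ψ.comp (MvPolynomial.optionEquivRight F (Fin n)).toAlgHom = MvPolynomial.aeval x := by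
    refine MvPolynomial.algHom_ext fun i => ?_
    cases i <;> simp [ψ]
  have hψi : Function.Injective ψ := by
    have h : ∀ p, ψ p = MvPolynomial.aeval x ((MvPolynomial.optionEquivRight F (Fin n)).symm p) :=
      fun p => by
      rw [← hψ]
      change _ = ψ (MvPolynomial.optionEquivRight F (Fin n) _)
      rw [AlgEquiv.apply_symm_apply]
    intro p q hpq
    rw [h, h] at hpq
    exact (MvPolynomial.optionEquivRight F (Fin n)).symm.injective (hx.1 hpq)
  have hrange : ∀ a ∈ Algebra.adjoin F (Set.range x), ∃ p, ψ p = a := fun a ha => by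
    rw [Algebra.adjoin_range_eq_range_aeval, ← hψ] at ha
    obtain ⟨p, hp⟩ := ha
    exact ⟨_, hp⟩
  have hmon : ∀ α, δ (ψ (MvPolynomial.monomial α 1)) =
      Polynomial.aeval (x none) (exponentPoly F α) * ψ (MvPolynomial.monomial α 1) := by
    intro α
    induction α using Finsupp.induction_linear with
    | zero => simp [exponentPoly]
    | add α β hα hβ =>
      rw [show (MvPolynomial.monomial (α + β) (1 : F[X])) =
        MvPolynomial.monomial α 1 * MvPolynomial.monomial β 1 by
          rw [MvPolynomial.monomial_mul, one_mul],
        map_mul, Derivation.leibniz, hα, hβ, exponentPoly_add, map_add]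
      simp only [smul_eq_mul]
      ring
    | single j k =>
      rw [← MvPolynomial.X_pow_eq_monomial, map_pow, Derivation.leibniz_pow]
      have h1 : exponentPoly F (Finsupp.single j k) =
          (k : F[X]) * Polynomial.X ^ (j.val + 1) := by
        rw [exponentPoly, Finset.sum_eq_single j]
        · rw [Finsupp.single_eq_same]
        · intro i _ hij
          rw [Finsupp.single_eq_of_ne hij]; simp
        · simp
      have h2 : ψ (MvPolynomial.X j) = x (some j) := by simp [ψ]
      rw [h1, h2, hδ]
      cases k with
      | zero => simp
      | succ k => simp; ring
  -- Pulled back along ψ, the derivation acts on each monomial separately, as g ↦ g' + weight · g on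
  -- its coefficient.
  have hT : ∀ p, ∃ p', (∀ α, MvPolynomial.coeff α p' =
      (p.coeff α).derivative + exponentPoly F α * p.coeff α) ∧ ψ p' = δ (ψ p) := by
    intro p
    induction p using MvPolynomial.induction_on' with
    | monomial α g =>
      refine ⟨MvPolynomial.monomial α (g.derivative + exponentPoly F α * g), fun β => ?_, ?_⟩
      · classical
        rw [MvPolynomial.coeff_monomial, MvPolynomial.coeff_monomial]
        split_ifs with h
        · rw [h]
        · simp
      · have hg : ∀ g, ψ (MvPolynomial.monomial α g) =
            Polynomial.aeval (x none) g * ψ (MvPolynomial.monomial α 1) := fun g => by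
          rw [← mul_one g, ← MvPolynomial.C_mul_monomial, map_mul, mul_one]
          simp [ψ]
        rw [hg, hg g, Derivation.leibniz, hmon, Derivation.map_aeval, hδ]
        simp
        ring
    | add p q hp hq =>
      obtain ⟨p', hp, hp'⟩ := hp
      obtain ⟨q', hq, hq'⟩ := hq
      refine ⟨p' + q', fun α => ?_, by rw [map_add, map_add, map_add, hp', hq']⟩
      rw [MvPolynomial.coeff_add, MvPolynomial.coeff_add, hp, hq, map_add]
      ring
  choose T hT hTψ using hT
  let T' : MvPolynomial (Fin n) F[X] →ₗ[F] MvPolynomial (Fin n) F[X] :=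
    { toFun := T
      map_add' p q := by
        ext1 α
        rw [MvPolynomial.coeff_add, hT, hT, hT, MvPolynomial.coeff_add, map_add]
        ring
      map_smul' c p := by
        ext1 α
        rw [RingHom.id_apply, MvPolynomial.coeff_smul, hT, hT, MvPolynomial.coeff_smul,
          Polynomial.derivative_smul, smul_add, mul_smul_comm] }
  have : Algebra.IsAlgebraic (IntermediateField.adjoin F (Set.range x)) K := hx.isAlgebraic_field
  have hmem : ∀ p, ψ p ∈ IntermediateField.adjoin F (Set.range x) := fun p => by
    refine IntermediateField.algebra_adjoin_le_adjoin F _ ?_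
    rw [Algebra.adjoin_range_eq_range_aeval, ← hψ]
    exact ⟨(MvPolynomial.optionEquivRight F (Fin n)).symm p,
      congrArg ψ (AlgEquiv.apply_symm_apply (MvPolynomial.optionEquivRight F (Fin n)) p)⟩
  -- It suffices to treat F(x), which `δ` preserves by the quotient rule. There δ(p/q) = 0 means T p
  -- · q = p · T q.
  refine ⟨δ, fun c => δ.isAlgebraic_of_eq_zero (IntermediateField.adjoin F (Set.range x))
    (fun a ha => ?_) fun a ha ha0 => ?_⟩
  · obtain ⟨r, hr, s, hs, rfl⟩ := IntermediateField.mem_adjoin_iff_div.mp ha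
    obtain ⟨p, rfl⟩ := hrange r hr
    obtain ⟨q, rfl⟩ := hrange s hs
    rw [Derivation.leibniz_div, ← hTψ, ← hTψ]
    simp only [smul_eq_mul]
    exact mul_mem (pow_mem (inv_mem (hmem _)) _)
      (sub_mem (mul_mem (hmem _) (hmem _)) (mul_mem (hmem _) (hmem _)))
  · obtain ⟨r, hr, s, hs, rfl⟩ := IntermediateField.mem_adjoin_iff_div.mp ha
    obtain ⟨p, rfl⟩ := hrange r hr
    obtain ⟨q, rfl⟩ := hrange s hs
    by_cases hq : q = 0
    · rw [hq, map_zero, div_zero]; exact isAlgebraic_zero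
    have hq' : ψ q ≠ 0 := (map_ne_zero_iff ψ hψi).mpr hq
    rw [Derivation.leibniz_div, smul_eq_mul, mul_eq_zero, or_iff_right (by simpa using hq'),
      sub_eq_zero, ← hTψ, ← hTψ, smul_eq_mul, smul_eq_mul, ← map_mul, ← map_mul] at ha0
    obtain ⟨c, hc⟩ := MvPolynomial.exists_eq_smul_of_diagonal T' hT hq (p := p)
      ((mul_comm _ _).trans (hψi ha0))
    rw [hc, map_smul, smul_div_assoc, div_self hq']
    exact (isAlgebraic_one).smul c

/-- If `F` has characteristic zero and is algebraically closed in `K`, then some derivation of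
`K` has field of constants `F`. -/
theorem exists_derivation_constants_eq
    (hclosed : ∀ x : K, IsAlgebraic F x → x ∈ Set.range (algebraMap F K))
    (hne : ∃ x : K, x ∉ Set.range (algebraMap F K)) :
    ∃ δ : Derivation F K K, ∀ a : K, δ a = 0 ↔ a ∈ Set.range (algebraMap F K) := by
  suffices h : ∃ δ : Derivation F K K, ∀ c, δ c = 0 → IsAlgebraic F c by
    obtain ⟨δ, hδ⟩ := h
    refine ⟨δ, fun a => ⟨fun h => hclosed a (hδ a h), ?_⟩⟩
    rintro ⟨c, rfl⟩
    exact δ.map_algebraMap c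
  obtain ⟨ι, x, hx⟩ := exists_isTranscendenceBasis' F K
  cases finite_or_infinite ι with
  | inl hfin =>
    have hι : Nonempty ι := by
      by_contra hι
      rw [not_nonempty_iff] at hι
      obtain ⟨y, hy⟩ := hne
      have : Algebra.IsAlgebraic F K := hx.isEmpty_iff_isAlgebraic.mp hι
      exact hy (hclosed y (Algebra.IsAlgebraic.isAlgebraic y))
    obtain ⟨n, ⟨e⟩⟩ := Finite.exists_equiv_fin ι
    cases n with
    | zero => exact (hι.map e).elim fun i => i.elim0
    | succ n =>
      let e' : Option (Fin n) ≃ ι := (finSuccEquiv n).symm.trans e.symm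
      exact exists_derivation_of_finite ((isTranscendenceBasis_equiv e').mpr hx)
  | inr hinf =>
    -- An infinite index set can be split into copies of ℕ, on which the shift lives.
    have hc : Cardinal.mk (ι × ℕ) = Cardinal.mk ι := by
      rw [Cardinal.mk_prod]
      simp [Cardinal.mul_aleph0_eq (Cardinal.aleph0_le_mk ι)]
    obtain ⟨e⟩ := Cardinal.eq.mp hc
    exact exists_derivation_of_infinite ((isTranscendenceBasis_equiv e).mpr hx)

end FiniteTranscendenceDegree

/-! ### Split algebras: Skolem–Noether, and B as the horizontal matrices. -/

section Splitting

variable {F K B : Type*} [Field F] [Field K] [Algebra F K] [Ring B] [Algebra F B]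

/-- The Skolem–Noether theorem for automorphisms of a split simple algebra. -/
theorem AlgEquiv.exists_conj_of_split [IsSimpleRing B] [FiniteDimensional F B] {n : Type*}
    [Fintype n] [DecidableEq n]
    (ψ : K ⊗[F] B ≃ₐ[K] Matrix n n K) (σ : B ≃ₐ[F] B) :
    ∃ u : Bˣ, ∀ b, σ b = u * b * (u⁻¹ : Bˣ) := by
  classical
  let σK : K ⊗[F] B ≃ₐ[K] K ⊗[F] B := Algebra.TensorProduct.congr AlgEquiv.refl σ
  let θ : K ⊗[F] B ≃ₐ[K] Module.End K (n → K) := ψ.trans Matrix.toLinAlgEquiv'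
  obtain ⟨T, hT⟩ := AlgEquiv.eq_linearEquivConjAlgEquiv ((θ.symm.trans σK).trans θ)
  have hT' : ∀ z, θ (σK z) * T.toLinearMap = T.toLinearMap * θ z := by
    intro z
    have h := congrArg (fun f : Module.End K (n → K) ≃ₐ[K] Module.End K (n → K) => f (θ z)) hT
    simp only [AlgEquiv.trans_apply, AlgEquiv.symm_apply_apply] at h
    rw [h]
    refine LinearMap.ext fun v => ?_
    simp [LinearEquiv.conjAlgEquiv_apply]
  -- After extension to K, σ is conjugation by T; thus t intertwines 1 ⊗ b and 1 ⊗ σ(b).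
  set t : K ⊗[F] B := θ.symm T.toLinearMap with ht
  have hσt : ∀ b, (1 ⊗ₜ σ b : K ⊗[F] B) * t = t * 1 ⊗ₜ b := fun b => θ.injective (by
    rw [map_mul, map_mul, ht, AlgEquiv.apply_symm_apply, ← hT' (1 ⊗ₜ b)]
    rfl)
  have ht0 : t ≠ 0 := by
    have : Nontrivial (K ⊗[F] B) := by
      exact (Algebra.TensorProduct.includeRight_injective
        (FaithfulSMul.algebraMap_injective F K) (A := K) (B := B)).nontrivial
    intro h0
    rw [ht, EmbeddingLike.map_eq_zero_iff] at h0
    have h1 : θ 1 = θ 0 := LinearMap.ext fun v => T.injective (by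
      rw [map_one, map_zero, LinearMap.zero_apply, map_zero]
      exact LinearMap.congr_fun h0 v)
    exact one_ne_zero (θ.injective h1)
  -- Descent to F: in an F-basis of K, every coordinate u of t lies in B and satisfies σ(b)u = ub;
  -- some coordinate is nonzero.
  let e := TensorProduct.equivFinsuppOfBasisLeft (N := B) (Module.Basis.ofVectorSpace F K)
  obtain ⟨i, hi⟩ : ∃ i, e t i ≠ 0 := by
    by_contra! h
    exact ht0 (e.injective (by rw [map_zero]; exact Finsupp.ext h))
  have hl : ∀ b z, e ((1 ⊗ₜ b) * z) i = b * e z i := fun b z => by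
    induction z with
    | zero => simp
    | add x y hx hy => rw [mul_add, map_add, Finsupp.add_apply, hx, hy, map_add, Finsupp.add_apply,
        mul_add]
    | tmul x y => simp [e]
  have hr : ∀ b z, e (z * (1 ⊗ₜ b)) i = e z i * b := fun b z => by
    induction z with
    | zero => simp
    | add x y hx hy => rw [add_mul, map_add, Finsupp.add_apply, hx, hy, map_add, Finsupp.add_apply,
        add_mul]
    | tmul x y => simp [e]
  set u := e t i with hu
  have hσu : ∀ b, σ b * u = u * b := fun b => by rw [hu, ← hl, hσt, hr]
  -- The left ideal Bu is two-sided because ua = σ(a)u. Simplicity makes u left invertible, and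
  -- finite dimension then makes it a unit.
  let I : TwoSidedIdeal B := .mk' {x | ∃ b, x = b * u} ⟨0, by simp⟩
    (by rintro _ _ ⟨b, rfl⟩ ⟨c, rfl⟩; exact ⟨b + c, by rw [add_mul]⟩)
    (by rintro _ ⟨b, rfl⟩; exact ⟨-b, by rw [neg_mul]⟩)
    (by rintro a _ ⟨b, rfl⟩; exact ⟨a * b, by rw [mul_assoc]⟩)
    (by rintro _ a ⟨b, rfl⟩; exact ⟨b * σ a, by rw [mul_assoc, mul_assoc, hσu]⟩)
  have hI : ∀ x, x ∈ I ↔ ∃ b, x = b * u := fun x => TwoSidedIdeal.mem_mk' ..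
  have hIt : I = ⊤ := (eq_bot_or_eq_top I).resolve_left fun h => by
    have h1 : u ∈ I := (hI u).mpr ⟨1, (one_mul u).symm⟩
    rw [h, TwoSidedIdeal.mem_bot] at h1
    exact hi h1
  obtain ⟨w, hw⟩ := (hI 1).mp (hIt ▸ TwoSidedIdeal.mem_top B)
  have : IsArtinianRing B := IsArtinianRing.of_finite F B
  have hw' : u * w = 1 := by
    exact mul_eq_one_symm hw.symm
  refine ⟨⟨u, w, hw', hw.symm⟩, fun b => ?_⟩
  change σ b = u * b * w
  rw [← hσu, mul_assoc, hw', mul_one]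

/-- A `K`-linear derivation of a matrix algebra is inner. -/
theorem Matrix.exists_eq_commutator_of_leibniz {n : Type*} [Fintype n] [DecidableEq n] (i₀ : n)
    (E : Matrix n n K →ₗ[K] Matrix n n K) (hE : ∀ X Y, E (X * Y) = E X * Y + X * E Y) :
    ∃ P, ∀ X, E X = P * X - X * P := by
  -- P = ∑ E(e_{k i₀}) e_{i₀ k}. By Leibniz, XP = ∑ E(X e_{k i₀}) e_{i₀ k} − E(X), and expanding X
  -- e_{k i₀} in matrix units turns the sum into PX.
  refine ⟨∑ k, E (Matrix.single k i₀ 1) * Matrix.single i₀ k 1, fun X => ?_⟩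
  have h1 : ∀ k, X * Matrix.single k i₀ 1 = ∑ l, X l k • Matrix.single l i₀ (1 : K) := fun k => by
    ext a b
    simp [Matrix.sum_apply, Matrix.mul_apply, Matrix.single_apply, ite_and]
  have h2 : ∀ l, Matrix.single i₀ l 1 * X = ∑ k, X l k • Matrix.single i₀ k (1 : K) := fun l => by
    ext a b
    simp [Matrix.sum_apply, Matrix.mul_apply, Matrix.single_apply, ite_and]
  have h3 : X * ∑ k, E (Matrix.single k i₀ 1) * Matrix.single i₀ k 1 =
      (∑ k, E (Matrix.single k i₀ 1) * Matrix.single i₀ k 1) * X - E X := by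
    have h4 : ∀ k, X * (E (Matrix.single k i₀ 1) * Matrix.single i₀ k 1) =
        E (X * Matrix.single k i₀ 1) * Matrix.single i₀ k 1 - E X * Matrix.single k k 1 :=
      fun k => by
        rw [hE, add_mul, mul_assoc (E X), Matrix.single_mul_single_same, one_mul, mul_assoc X,
          add_sub_cancel_left]
    rw [Finset.mul_sum, Finset.sum_congr rfl fun k _ => h4 k, Finset.sum_sub_distrib,
      ← Finset.mul_sum, Matrix.sum_single_one, mul_one, Finset.sum_mul]
    congr 1
    simp_rw [h1, map_sum, map_smul, Finset.sum_mul, smul_mul_assoc]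
    rw [Finset.sum_comm]
    refine Finset.sum_congr rfl fun l _ => ?_
    rw [mul_assoc, h2, Finset.mul_sum]
    simp_rw [mul_smul_comm]
  rw [h3, sub_sub_cancel]

/-- Coefficientwise differentiation of a splitting differs from `δ ⊗ 1` by a commutator. -/
theorem exists_horizontal_iff {n : Type*} [Fintype n] [DecidableEq n] (i₀ : n)
    [FiniteDimensional F B]
    (δ : Derivation F K K) (hδ : ∀ a : K, δ a = 0 ↔ a ∈ Set.range (algebraMap F K))
    (ψ : K ⊗[F] B ≃ₐ[K] Matrix n n K) :
    ∃ P : Matrix n n K, ∀ X : Matrix n n K,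
      X.map δ = P * X - X * P ↔ ∃ b : B, ψ (1 ⊗ₜ b) = X := by
  let d : K ⊗[F] B →ₗ[F] K ⊗[F] B := δ.toLinearMap.rTensor B
  have hd_tmul : ∀ a b, d (a ⊗ₜ b) = δ a ⊗ₜ b := fun a b => rfl
  have hd_smul : ∀ (a : K) z, d (a • z) = a • d z + δ a • z := fun a z => by
    induction z with
    | zero => simp
    | add x y hx hy => rw [smul_add, map_add, hx, hy, map_add, smul_add, smul_add]; abel
    | tmul x y =>
      rw [TensorProduct.smul_tmul', hd_tmul, hd_tmul, TensorProduct.smul_tmul',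
        TensorProduct.smul_tmul', ← TensorProduct.add_tmul, smul_eq_mul, Derivation.leibniz]
      simp [mul_comm]
  have hd_mul : ∀ z w, d (z * w) = d z * w + z * d w := fun z w => by
    induction z with
    | zero => simp
    | add x y hx hy => rw [add_mul, map_add, hx, hy, map_add, add_mul, add_mul]; abel
    | tmul x y =>
      induction w with
      | zero => simp
      | add x y hx hy => rw [mul_add, map_add, hx, hy, map_add, mul_add, mul_add]; abel
      | tmul x' y' =>
        simp only [Algebra.TensorProduct.tmul_mul_tmul, hd_tmul]
        rw [← TensorProduct.add_tmul, Derivation.leibniz]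
        simp [mul_comm, add_comm]
  have hd_zero : ∀ z, d z = 0 ↔ ∃ b : B, 1 ⊗ₜ b = z := fun z => by
    constructor
    · intro h
      let b := Module.finBasis F B
      let bK := Algebra.TensorProduct.basis K b
      -- In an F-basis of B, d differentiates the coordinates, so its kernel consists of the vectors
      -- with coordinates in F.
      have hrepr : ∀ z i, bK.repr (d z) i = δ (bK.repr z i) := fun z i => by
        induction z with
        | zero => simp
        | add x y hx hy => simp only [map_add, Finsupp.add_apply, hx, hy]
        | tmul x y => simp [bK, hd_tmul, mul_comm]
      have hc : ∀ i, ∃ c : F, algebraMap F K c = bK.repr z i := fun i =>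
        (hδ _).mp (by rw [← hrepr, h, map_zero, Finsupp.zero_apply])
      choose c hc using hc
      refine ⟨∑ i, c i • b i, ?_⟩
      rw [← bK.sum_repr z, TensorProduct.tmul_sum]
      refine Finset.sum_congr rfl fun i _ => ?_
      rw [← hc, algebraMap_smul, TensorProduct.tmul_smul, Algebra.TensorProduct.basis_apply]
    · rintro ⟨b, rfl⟩
      rw [hd_tmul, Derivation.map_one_eq_zero, TensorProduct.zero_tmul]
  -- Both terms obey Leibniz over the same `δ`, so the δ(a)X parts cancel and the difference is
  -- K-linear.
  let E : Matrix n n K →ₗ[K] Matrix n n K :=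
    { toFun X := X.map δ - ψ (d (ψ.symm X))
      map_add' X Y := by
        rw [map_add, map_add, map_add, Matrix.map_add _ (map_add δ)]; abel
      map_smul' a X := by
        rw [map_smul, hd_smul, map_add, map_smul, map_smul, ψ.apply_symm_apply, RingHom.id_apply,
          smul_sub]
        have : (a • X).map δ = a • X.map δ + δ a • X := by
          ext i j; simp [mul_comm]
        rw [this]; abel }
  have hEd : ∀ X, E X = X.map δ - ψ (d (ψ.symm X)) := fun X => rfl
  obtain ⟨P, hP⟩ := Matrix.exists_eq_commutator_of_leibniz i₀ E fun X Y => by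
    have : (X * Y).map δ = X.map δ * Y + X * Y.map δ := by
      ext i j
      simp only [Matrix.map_apply, Matrix.mul_apply, Matrix.add_apply, map_sum,
        ← Finset.sum_add_distrib, Derivation.leibniz]
      refine Finset.sum_congr rfl fun k _ => ?_
      simp only [smul_eq_mul]; ring
    rw [hEd, hEd, hEd, map_mul, hd_mul, map_add, map_mul, map_mul, ψ.apply_symm_apply,
      ψ.apply_symm_apply, this]
    noncomm_ring
  refine ⟨P, fun X => ?_⟩
  rw [← hP, hEd, eq_comm, sub_eq_self, EmbeddingLike.map_eq_zero_iff, hd_zero]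
  exact exists_congr fun b => ψ.toEquiv.eq_symm_apply

end Splitting

/-! ### Simplicity of K[t;δ], cyclic vectors and annihilators. -/

namespace DiffPoly

section

variable {F K : Type*} [CommRing F] [Field K] [Algebra F K] {δ : Derivation F K K}

theorem toPoly_C (a : K) : toPoly (C a : DiffPoly δ) = Polynomial.C a := by
  change a • toPoly (1 : DiffPoly δ) = _
  rw [toPoly_one, Polynomial.smul_eq_C_mul, mul_one]

theorem C_mul (a : K) (p : DiffPoly δ) : C a * p = a • p := by
  change (a • (1 : DiffPoly δ)) * p = _
  rw [smul_mul_assoc, one_mul]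

/-- The second term of t^(k+1) a = a t^(k+1) + (k+1) δ(a) t^k + ⋯, which controls commutators with
constants. -/
theorem coeff_tMul_pow_succ_C (a : K) (k : ℕ) :
    ((tMul δ ^ (k + 1)) (Polynomial.C a)).coeff k = (k + 1) * δ a := by
  induction k with
  | zero => simp [tMul_apply]
  | succ k ih =>
    rw [pow_succ', Module.End.mul_apply, tMul_apply, Polynomial.coeff_add, Polynomial.coeff_X_mul,
      ih, coeff_coeffDeriv, coeff_tMul_pow _ _ _ (by simp), if_pos (by simp),
      Polynomial.leadingCoeff_C]
    push_cast; ring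

theorem coeff_mul_C (p : DiffPoly δ) (a : K) {k : ℕ} (hk : (toPoly p).natDegree ≤ k + 1) :
    (toPoly (p * C a)).coeff k =
      (toPoly p).coeff k * a + (toPoly p).coeff (k + 1) * ((k + 1) * δ a) := by
  rw [toPoly_mul, toPoly_C, leftMul, Polynomial.sum_over_range' _ _ (k + 2) (by omega),
    LinearMap.sum_apply, Polynomial.finsetSum_coeff, Finset.sum_range_succ, Finset.sum_range_succ,
    Finset.sum_eq_zero, zero_add]
  · simp only [LinearMap.smul_apply, Polynomial.coeff_smul, smul_eq_mul, coeff_tMul_pow_succ_C]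
    rw [coeff_tMul_pow _ _ _ (by simp), if_pos (by simp), Polynomial.leadingCoeff_C]
  · intro i hi
    rw [Finset.mem_range] at hi
    rw [LinearMap.smul_apply, Polynomial.coeff_smul, coeff_tMul_pow _ _ _ (by simp; omega),
      if_neg (by simp; omega), smul_zero]
  · simp

/-- In characteristic zero, `K[t;δ]` is a simple ring if `δ ≠ 0`. -/
theorem isSimpleRing [CharZero K] (hδ : ∃ a, δ a ≠ 0) : IsSimpleRing (DiffPoly δ) := by
  obtain ⟨a, ha⟩ := hδ
  have key : ∀ (I : TwoSidedIdeal (DiffPoly δ)) (n : ℕ) (p : DiffPoly δ), p ∈ I → p ≠ 0 →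
      (toPoly p).natDegree = n → (1 : DiffPoly δ) ∈ I := by
    intro I n
    induction n with
    | zero =>
      intro p hp hp0 hn
      obtain ⟨c, hc⟩ := Polynomial.natDegree_eq_zero.mp hn
      have hpc : p = C c := by ext1; rw [toPoly_C, hc]
      have hc0 : c ≠ 0 := by rintro rfl; exact hp0 (by rw [hpc, map_zero])
      rw [show (1 : DiffPoly δ) = C c⁻¹ * p by rw [hpc, ← map_mul, inv_mul_cancel₀ hc0, map_one]]
      exact I.mul_mem_left _ _ hp
    | succ n ih =>
      intro p hp hp0 hn
      -- In the commutator with a the leading terms cancel and degree n gets a nonzero coefficient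
      -- in characteristic 0, so the degree in the ideal falls by exactly one.
      have hco : ∀ k, n ≤ k → (toPoly (p * C a - C a * p)).coeff k =
          (toPoly p).coeff (k + 1) * ((k + 1) * δ a) := fun k hk => by
        rw [map_sub, Polynomial.coeff_sub, coeff_mul_C _ _ (by omega), C_mul, map_smul,
          Polynomial.coeff_smul, smul_eq_mul]
        ring
      have hne : (toPoly (p * C a - C a * p)).coeff n ≠ 0 := by
        rw [hco n le_rfl, ← hn, Polynomial.coeff_natDegree]
        refine mul_ne_zero ?_ (mul_ne_zero (by exact_mod_cast n.succ_ne_zero) ha)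
        rw [Polynomial.leadingCoeff_ne_zero]
        exact fun h => hp0 (toPoly_eq_zero.mp h)
      refine ih (p * C a - C a * p) (I.sub_mem (I.mul_mem_right _ _ hp) (I.mul_mem_left _ _ hp))
        (fun h0 => hne (by rw [h0, map_zero, Polynomial.coeff_zero])) ?_
      refine le_antisymm (Polynomial.natDegree_le_iff_coeff_eq_zero.mpr fun k hk => ?_)
        (Polynomial.le_natDegree_of_ne_zero hne)
      rw [hco k hk.le, Polynomial.coeff_eq_zero_of_natDegree_lt (by omega), zero_mul]
  have : Nontrivial (DiffPoly δ) := ⟨0, 1, fun h => zero_ne_one (congrArg toPoly h)⟩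
  refine ⟨⟨fun I => ?_⟩⟩
  by_cases h : ∃ p ∈ I, p ≠ 0
  · obtain ⟨p, hp, hp0⟩ := h
    exact .inr (I.one_mem_iff.mp (key I _ p hp hp0 rfl))
  · push Not at h
    exact .inl (le_bot_iff.mp fun p hp => (TwoSidedIdeal.mem_bot _).mpr (h p hp))

variable {W : Type*} [AddCommGroup W] [Module K W] [Module (DiffPoly δ) W]
  [IsScalarTower K (DiffPoly δ) W]

/-- K[t;δ] is infinite-dimensional over K, so p ↦ p w cannot be injective. -/
theorem exists_smul_eq_zero [FiniteDimensional K W] (w : W) :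
    ∃ p : DiffPoly δ, p ≠ 0 ∧ p • w = 0 := by
  let l : DiffPoly δ →ₗ[K] W := (LinearMap.toSpanSingleton (DiffPoly δ) W w).restrictScalars K
  by_contra! h
  have hinj : Function.Injective l := (injective_iff_map_eq_zero l).mpr fun p hp => by
    by_contra hp0
    exact h p hp0 hp
  have hfin : FiniteDimensional K K[X] :=
    FiniteDimensional.of_injective (l ∘ₗ toPoly.symm.toLinearMap) (hinj.comp toPoly.symm.injective)
  exact Polynomial.not_finite hfin

/-- The cyclic vector theorem. -/
theorem exists_cyclic [CharZero K] (hδ : ∃ a, δ a ≠ 0) [FiniteDimensional K W] :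
    ∃ w : W, Submodule.span (DiffPoly δ) {w} = ⊤ := by
  have := isSimpleRing hδ
  have : IsArtinian (DiffPoly δ) W := isArtinian_of_tower K inferInstance
  have : IsNoetherian (DiffPoly δ) W := isNoetherian_of_tower K inferInstance
  -- Choose v and a minimal N with R v + N = W, where R = K[t;δ]. If N ≠ 0, replacing v by some v +
  -- n will allow a maximal submodule M of N to take its place.
  let S : Set (Submodule (DiffPoly δ) W) := {N | ∃ v, Submodule.span (DiffPoly δ) {v} ⊔ N = ⊤}
  obtain ⟨N, ⟨v, hv⟩, hmin⟩ := (IsWellFounded.wf (r := (· < ·))).has_min S ⟨⊤, 0, by simp⟩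
  by_cases hN : N = ⊥
  · exact ⟨v, by rw [← hv, hN, sup_bot_eq]⟩
  exfalso
  obtain ⟨M, -, hM⟩ := exists_le_covBy_of_lt (bot_lt_iff_ne_bot.mpr hN)
  obtain ⟨p, hp0, hp⟩ := exists_smul_eq_zero (δ := δ) v
  -- The annihilator of N/M is a proper ideal, hence zero. So an annihilator p ≠ 0 of v moves some n
  -- ∈ N outside M.
  let I : TwoSidedIdeal (DiffPoly δ) := .mk' {r | ∀ n ∈ N, r • n ∈ M} (fun n _ => by simp)
    (fun hx hy n hn => by rw [add_smul]; exact M.add_mem (hx n hn) (hy n hn))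
    (fun hx n hn => by rw [neg_smul]; exact M.neg_mem (hx n hn))
    (fun hy n hn => by rw [mul_smul]; exact M.smul_mem _ (hy n hn))
    (fun hx n hn => by rw [mul_smul]; exact hx _ (N.smul_mem _ hn))
  have hI : ∀ r, r ∈ I ↔ ∀ n ∈ N, r • n ∈ M := fun r => TwoSidedIdeal.mem_mk' ..
  obtain ⟨n, hn, hpn⟩ : ∃ n ∈ N, p • n ∉ M := by
    by_contra! h
    rcases eq_bot_or_eq_top I with hI' | hI'
    · have h1 : p ∈ I := (hI p).mpr h
      rw [hI', TwoSidedIdeal.mem_bot] at h1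
      exact hp0 h1
    · have h1 : (1 : DiffPoly δ) ∈ I := hI' ▸ TwoSidedIdeal.mem_top _
      exact hM.lt.not_ge fun n hn => one_smul (DiffPoly δ) n ▸ (hI 1).mp h1 n hn
  set T := Submodule.span (DiffPoly δ) {v + n} ⊔ M with hT
  have hvn : v + n ∈ T := Submodule.mem_sup_left (Submodule.mem_span_singleton_self _)
  -- p(v + n) = pn, so T meets N in more than M. Maximality of M gives N ≤ T, hence v ∈ T and T = W.
  have hpnT : p • n ∈ T := by
    have := T.smul_mem p hvn
    rwa [smul_add, hp, zero_add] at this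
  have hNT : N ≤ T := by
    have h1 : M < N ⊓ T := lt_of_le_of_ne (le_inf hM.le le_sup_right)
      fun h => hpn (h ▸ ⟨N.smul_mem p hn, hpnT⟩)
    exact inf_eq_left.mp (hM.eq_or_eq h1.le inf_le_left |>.resolve_left h1.ne')
  refine hmin M ⟨v + n, top_le_iff.mp (hv ▸ sup_le ?_ hNT)⟩ hM.lt
  rw [Submodule.span_singleton_le_iff_mem]
  simpa using T.sub_mem hvn (hNT hn)

end

section

variable {F K : Type*} [CommRing F] [Field K] [Algebra F K] {δ : Derivation F K K}
  {W : Type*} [AddCommGroup W] [Module F W] [Module K W] [IsScalarTower F K W]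

/-- The action of differential polynomials on a space with a connection. -/
def connectionHom (D : Module.End F W) (hD : ∀ (a : K) w, D (a • w) = a • D w + δ a • w) :
    DiffPoly δ →+* Module.End F W where
  toFun p := (toPoly p).sum fun i a => a • D ^ i
  map_zero' := Polynomial.sum_zero_index _
  map_add' p q := Polynomial.sum_add_index _ _ _ (fun i => zero_smul K _)
    (fun i a b => add_smul a b _)
  map_one' := by
    rw [toPoly_one, ← Polynomial.monomial_zero_one,
      Polynomial.sum_monomial_index _ _ (zero_smul K _), one_smul, pow_zero]
  map_mul' p q := by
    let ρ : K[X] →+ Module.End F W :=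
      { toFun p := p.sum fun i a => a • D ^ i
        map_zero' := Polynomial.sum_zero_index _
        map_add' p q := Polynomial.sum_add_index _ _ _ (fun i => zero_smul K _)
          (fun i a b => add_smul a b _) }
    have hm : ∀ n a, ρ (Polynomial.monomial n a) = a • D ^ n := fun n a =>
      by
      change (Polynomial.monomial n a).sum (fun i a => a • D ^ i) = _
      exact Polynomial.sum_monomial_index a _ (zero_smul K _)
    have hs : ∀ (a : K) p, ρ (a • p) = a • ρ p := fun a p => by
      induction p using Polynomial.induction_on' with
      | add p q hp hq => rw [smul_add, map_add, hp, hq, map_add, smul_add]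
      | monomial n b => rw [Polynomial.smul_monomial, hm, hm, smul_smul, smul_eq_mul]
    have ht : ∀ g, ρ (tMul δ g) = D * ρ g := fun g => by
      induction g using Polynomial.induction_on' with
      | add p q hp hq => rw [map_add, map_add, hp, hq, map_add, mul_add]
      | monomial n a =>
        rw [tMul_apply, map_add, Polynomial.X_mul_monomial, coeffDeriv_monomial, hm, hm, hm]
        ext1 w
        simp [hD, pow_succ']
    have hl : ∀ p q, ρ (leftMul δ p q) = ρ p * ρ q := fun p q => by
      induction p using Polynomial.induction_on' with
      | add p p' hp hp' => rw [leftMul_add, LinearMap.add_apply, map_add, hp, hp', map_add, add_mul]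
      | monomial n a =>
        rw [leftMul_monomial, LinearMap.smul_apply, hs, hm, smul_mul_assoc]
        congr 1
        induction n with
        | zero => simp
        | succ n ih => rw [pow_succ', Module.End.mul_apply, ht, ih, pow_succ', mul_assoc]
    exact hl _ _

theorem connectionHom_C (D : Module.End F W) (hD : ∀ (a : K) w, D (a • w) = a • D w + δ a • w)
    (a : K) (w : W) : connectionHom D hD (C a) w = a • w := by
  change (toPoly (C a : DiffPoly δ)).sum (fun i a => a • D ^ i) w = _
  rw [toPoly_C, Polynomial.sum_C_index (zero_smul K _)]
  rfl

theorem connectionHom_comm (D : Module.End F W)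
    (hD : ∀ (a : K) w, D (a • w) = a • D w + δ a • w) (L : Module.End F W)
    (hL : ∀ (a : K) w, L (a • w) = a • L w) (hLD : ∀ w, L (D w) = D (L w))
    (p : DiffPoly δ) (w : W) :
    L (connectionHom D hD p w) = connectionHom D hD p (L w) := by
  have h : ∀ (i : ℕ) w, L ((D ^ i) w) = (D ^ i) (L w) := fun i => by
    induction i with
    | zero => exact fun w => rfl
    | succ i ih =>
      intro w
      rw [pow_succ, Module.End.mul_apply, Module.End.mul_apply, ih, hLD]
  change L ((toPoly p).sum (fun i a => a • D ^ i) w) = (toPoly p).sum (fun i a => a • D ^ i) (L w)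
  rw [Polynomial.sum_def, LinearMap.sum_apply, LinearMap.sum_apply, map_sum]
  exact Finset.sum_congr rfl fun i _ => by rw [LinearMap.smul_apply, LinearMap.smul_apply, hL, h]

theorem connectionHom_t (D : Module.End F W) (hD : ∀ (a : K) w, D (a • w) = a • D w + δ a • w) :
    connectionHom D hD t = D := by
  change (Polynomial.X : K[X]).sum (fun i a => a • D ^ i) = _
  rw [Polynomial.sum_X_index (zero_smul K _), one_smul, pow_one]

end

end DiffPoly

namespace DiffPoly

variable {F K : Type*} [CommRing F] [Field K] [Algebra F K] {δ : Derivation F K K}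

theorem toPoly_t_pow (i : ℕ) : toPoly ((t : DiffPoly δ) ^ i) = Polynomial.X ^ i := by
  rw [← tMul_pow_one (δ := δ)]
  induction i with
  | zero => rfl
  | succ i ih =>
    rw [pow_succ', toPoly_mul, ih, pow_succ', Module.End.mul_apply]
    change leftMul δ Polynomial.X _ = _
    rw [← Polynomial.monomial_one_one_eq_X, leftMul_monomial, one_smul, pow_one]

theorem degree_t_pow (i : ℕ) : degree ((t : DiffPoly δ) ^ i) = i := by
  rw [degree, toPoly_t_pow, Polynomial.degree_X_pow]

theorem eq_C_of_degree_le_zero {p : DiffPoly δ} (h : degree p ≤ 0) : ∃ c, p = C c :=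
  ⟨(toPoly p).coeff 0, by ext1; rw [toPoly_C]; exact Polynomial.eq_C_of_degree_le_zero h⟩

theorem finrank_degreeLT (d : ℕ) : Module.finrank K (degreeLT δ d) = d := by
  have e : degreeLT δ d ≃ₗ[K] Polynomial.degreeLT K d :=
    LinearEquiv.ofSubmodules toPoly _ _ (by
      ext p
      rw [Polynomial.mem_degreeLT]
      constructor
      · rintro ⟨q, hq, rfl⟩; exact hq
      · intro hp; exact ⟨toPoly.symm p, hp, rfl⟩)
  rw [e.finrank_eq, (Polynomial.degreeLTEquiv K d).finrank_eq, Module.finrank_fin_fun]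

variable {W : Type*} [AddCommGroup W] [Module K W] [Module (DiffPoly δ) W]
  [IsScalarTower K (DiffPoly δ) W]

/-- The annihilator of a cyclic vector of an `m`-dimensional differential module is generated by a
differential polynomial of degree `m`. -/
theorem exists_annihilator [FiniteDimensional K W] {w : W}
    (hw : Submodule.span (DiffPoly δ) {w} = ⊤) :
    ∃ f : DiffPoly δ, f ≠ 0 ∧ f.natDegree = Module.finrank K W ∧
      ∀ g : DiffPoly δ, g • w = 0 ↔ ∃ q, g = q * f := by
  classical
  have hex : ∃ n, ∃ p : DiffPoly δ, p ≠ 0 ∧ p • w = 0 ∧ natDegree p = n := by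
    obtain ⟨p, hp, hpw⟩ := exists_smul_eq_zero (δ := δ) w
    exact ⟨_, p, hp, hpw, rfl⟩
  obtain ⟨f, hf, hfw, hn⟩ := Nat.find_spec hex
  have hf' : degree f = natDegree f :=
    Polynomial.degree_eq_natDegree fun h => hf (toPoly_eq_zero.mp h)
  have hmin : ∀ g : DiffPoly δ, degree g < degree f → g • w = 0 → g = 0 := fun g hg hgw => by
    by_contra hg0
    refine Nat.find_min hex (m := natDegree g) ?_ ⟨g, hg0, hgw, rfl⟩
    rw [← hn]
    rw [hf', degree, Polynomial.degree_eq_natDegree fun h => hg0 (toPoly_eq_zero.mp h)] at hg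
    exact_mod_cast hg
  -- With f of least degree, evaluating remainders at w is injective by minimality and surjective by
  -- right division; this gives deg f = dim W.
  let l : degreeLT δ (natDegree f) →ₗ[K] W :=
    ((LinearMap.toSpanSingleton (DiffPoly δ) W w).restrictScalars K).domRestrict _
  have hl : Function.Bijective l := by
    constructor
    · refine (injective_iff_map_eq_zero l).mpr fun g hg => Subtype.ext (hmin g ?_ hg)
      rw [hf']
      exact g.2
    · intro v
      obtain ⟨g, hg⟩ := Submodule.mem_span_singleton.mp (hw ▸ Submodule.mem_top : v ∈ _)
      obtain ⟨h1, q, h2⟩ := modR_spec g f hf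
      refine ⟨⟨modR g f, modR_mem g f⟩, ?_⟩
      change modR g f • w = v
      rw [← hg]
      conv_rhs => rw [h2, add_smul, mul_smul, hfw, smul_zero, zero_add]
  refine ⟨f, hf, ?_, fun g => ⟨fun hg => ?_, ?_⟩⟩
  · rw [← (LinearEquiv.ofBijective l hl).finrank_eq, finrank_degreeLT]
  · obtain ⟨h1, q, h2⟩ := modR_spec g f hf
    refine ⟨q, ?_⟩
    rw [h2, add_smul, mul_smul, hfw, smul_zero, zero_add] at hg
    rw [hmin _ h1 hg, add_zero] at h2
    exact h2
  · rintro ⟨q, rfl⟩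
    rw [mul_smul, hfw, smul_zero]

end DiffPoly

/-! ### The nuclei of S_f through its differential module. -/

namespace PetitAlgebra

open DiffPoly

section

variable {F K : Type*} [CommRing F] [Field K] [Algebra F K] {δ : Derivation F K K}
  {f : DiffPoly δ}

theorem const_eq_smul (c : K) : const f c = c • (1 : PetitAlgebra f) := mk_smul c 1

theorem val_smul_one (hf : f.natDegree ≠ 0) (c : K) : val (c • (1 : PetitAlgebra f)) = C c := by
  rw [← const_eq_smul]
  refine modR_of_mem ?_
  change degree _ < _
  rw [degree, toPoly_C]
  exact lt_of_le_of_lt Polynomial.degree_C_le (by exact_mod_cast Nat.pos_of_ne_zero hf)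

theorem mem_range_const (hf : f.natDegree ≠ 0) {x : PetitAlgebra f} (hx : degree (val x) ≤ 0) :
    x ∈ (const f).range := by
  obtain ⟨c, hc⟩ := eq_C_of_degree_le_zero hx
  exact ⟨c, ext (by rw [const_eq_smul, val_smul_one hf, hc])⟩

theorem const_mem_leftNucleus (c : K) : const f c ∈ leftNucleus (PetitAlgebra f) := fun y z => by
  rw [associator_apply, const_eq_smul, smul_mul_assoc, smul_mul_assoc, smul_mul_assoc, one_mul,
    one_mul, sub_self]

/-- Multiplication by a constant on either side does not raise the degree, so neither y∘c nor c∘z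
needs reduction modulo f. -/
theorem const_mem_middleNucleus (hf : f.natDegree ≠ 0) (c : K) :
    const f c ∈ middleNucleus (PetitAlgebra f) := fun y z => by
  have h : val (y * c • (1 : PetitAlgebra f)) = val y * C c := by
    rw [mul_def, val_smul_one hf]
    refine modR_of_mem ?_
    change degree _ < _
    rw [DiffPoly.degree_mul]
    refine lt_of_le_of_lt ?_ (val_mem y : degree (val y) < _)
    refine (add_le_add_right ?_ _).trans (add_zero _).le
    rw [degree, toPoly_C]
    exact Polynomial.degree_C_le
  rw [associator_apply, const_eq_smul, smul_mul_assoc, one_mul, sub_eq_zero, mul_def _ z, h,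
    mul_def y, map_smul, ← C_mul, mul_assoc]

/-- S_f contains K, and K finite over F would be algebraic, hence equal to F. -/
theorem not_finite {F : Type*} [Field F] [Algebra F K] {δ : Derivation F K K}
    {f : DiffPoly δ} (hf : f.natDegree ≠ 0)
    (hclosed : ∀ x : K, IsAlgebraic F x → x ∈ Set.range (algebraMap F K))
    (hne : ∃ x : K, x ∉ Set.range (algebraMap F K)) : ¬ FiniteDimensional F (PetitAlgebra f) := by
  intro hfin
  obtain ⟨x, hx⟩ := hne
  let l : K →ₗ[F] PetitAlgebra f :=
    (LinearMap.toSpanSingleton K (PetitAlgebra f) 1).restrictScalars F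
  have hl : Function.Injective l := fun a b h => by
    have h' : val (a • (1 : PetitAlgebra f)) = val (b • (1 : PetitAlgebra f)) := congrArg val h
    rw [val_smul_one hf, val_smul_one hf] at h'
    have := congrArg toPoly h'
    rw [toPoly_C, toPoly_C] at this
    exact Polynomial.C_injective this
  have : FiniteDimensional F K := FiniteDimensional.of_injective l hl
  exact hx (hclosed x (Algebra.IsAlgebraic.isAlgebraic x))

end

section

variable {F K : Type*} [Field F] [Field K] [Algebra F K] {δ : Derivation F K K}
  {f : DiffPoly δ} {W : Type*} [AddCommGroup W] [Module K W] [Module (DiffPoly δ) W]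
  [IsScalarTower K (DiffPoly δ) W]

/-- The evaluation `x ↦ x w` of the Petit algebra at a vector of a differential module. -/
def evalAt (f : DiffPoly δ) (w : W) : PetitAlgebra f →ₗ[K] W :=
  (LinearMap.toSpanSingleton (DiffPoly δ) W w).restrictScalars K ∘ₗ val

theorem evalAt_apply (w : W) (x : PetitAlgebra f) : evalAt f w x = val x • w := rfl

theorem evalAt_mk {w : W} (hf : f ≠ 0) (hker : ∀ g : DiffPoly δ, g • w = 0 ↔ ∃ q, g = q * f)
    (g : DiffPoly δ) : evalAt f w (mk f g) = g • w := by
  obtain ⟨-, q, h⟩ := modR_spec g f hf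
  rw [evalAt_apply, val_mk]
  conv_rhs => rw [h, add_smul, (hker _).mpr ⟨q, rfl⟩, zero_add]

/-- Reduction modulo f is invisible at w, so the nonassociative product turns into the associative
action on W. -/
theorem evalAt_mul {w : W} (hf : f ≠ 0) (hker : ∀ g : DiffPoly δ, g • w = 0 ↔ ∃ q, g = q * f)
    (x y : PetitAlgebra f) : evalAt f w (x * y) = val x • evalAt f w y := by
  rw [mul_def, evalAt_mk hf hker, mul_smul, evalAt_apply]

end

end PetitAlgebra

namespace PetitAlgebra

open DiffPoly

section

variable {F K : Type*} [Field F] [Field K] [Algebra F K] {δ : Derivation F K K}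
  {f : DiffPoly δ} {W : Type*} [AddCommGroup W] [Module K W] [Module (DiffPoly δ) W]
  [IsScalarTower K (DiffPoly δ) W]

theorem evalAt_bijective {w : W} (hf : f ≠ 0)
    (hker : ∀ g : DiffPoly δ, g • w = 0 ↔ ∃ q, g = q * f)
    (hw : Submodule.span (DiffPoly δ) {w} = ⊤) : Function.Bijective (evalAt f w) := by
  constructor
  · refine (injective_iff_map_eq_zero _).mpr fun x hx => ?_
    obtain ⟨q, hq⟩ := (hker _).mp hx
    change val x = q * f at hq
    rw [← mk_val x, hq]
    refine ext ((modR_eq (q := q) ?_ (add_zero _).symm).trans (map_zero val).symm)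
    rw [degree_eq_bot.mpr rfl, bot_lt_iff_ne_bot]
    exact mt degree_eq_bot.mp hf
  · intro v
    obtain ⟨g, hg⟩ := Submodule.mem_span_singleton.mp (hw ▸ Submodule.mem_top : v ∈ _)
    exact ⟨mk f g, (evalAt_mk hf hker g).trans hg⟩

/-- From yz = qf + y∘z, the associator [y,z,x] evaluates to −q f (xw). -/
theorem associator_eq_zero_of_smul_eq_zero {w : W} (hf : f ≠ 0)
    (hker : ∀ g : DiffPoly δ, g • w = 0 ↔ ∃ q, g = q * f)
    (hw : Submodule.span (DiffPoly δ) {w} = ⊤) {x : PetitAlgebra f} (hx : f • evalAt f w x = 0) :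
    x ∈ rightNucleus (PetitAlgebra f) := fun y z => by
  obtain ⟨-, q, h⟩ := modR_spec (val y * val z) f hf
  refine (evalAt_bijective hf hker hw).1 ?_
  rw [associator_apply, map_sub, map_zero, evalAt_mul hf hker, evalAt_mul hf hker,
    evalAt_mul hf hker, ← mul_smul, h, add_smul, mul_smul, hx, smul_zero, zero_add]
  exact sub_self _

/-- A partial converse: if yz has the degree of f, then q is a nonzero constant and can be
cancelled, so a single vanishing associator suffices. -/
theorem smul_eq_zero_of_associator_eq_zero {w : W} (hf : f ≠ 0)
    (hker : ∀ g : DiffPoly δ, g • w = 0 ↔ ∃ q, g = q * f) {x y z : PetitAlgebra f}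
    (hyz : degree (val y * val z) = degree f) (h0 : associator y z x = 0) :
    f • evalAt f w x = 0 := by
  obtain ⟨h1, q, h⟩ := modR_spec (val y * val z) f hf
  have hq : degree (q * f) = degree f := by
    rw [eq_sub_of_add_eq h.symm, degree, map_sub, Polynomial.degree_sub_eq_left_of_degree_lt]
    · exact hyz
    · change degree _ < degree _
      rwa [hyz]
  have hf' : degree f = natDegree f :=
    Polynomial.degree_eq_natDegree fun h => hf (toPoly_eq_zero.mp h)
  rw [DiffPoly.degree_mul, hf'] at hq
  have hq0 : degree q = 0 := by
    have hne : degree q ≠ ⊥ := by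
      intro hb
      rw [hb] at hq
      simp at hq
    rw [degree, Polynomial.degree_eq_natDegree (mt Polynomial.degree_eq_bot.mpr hne)] at hq ⊢
    set k := (toPoly q).natDegree
    have h2 : k + natDegree f = natDegree f := by exact_mod_cast hq
    have h3 : k = 0 := by omega
    rw [h3]; rfl
  obtain ⟨c, rfl⟩ := eq_C_of_degree_le_zero hq0.le
  have hc : c ≠ 0 := by
    rintro rfl
    rw [map_zero, degree_eq_bot.mpr rfl] at hq0
    exact absurd hq0 (by simp)
  have h2 := congrArg (evalAt f w) h0
  rw [associator_apply, map_sub, map_zero, evalAt_mul hf hker, evalAt_mul hf hker,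
    evalAt_mul hf hker, ← mul_smul, h, add_smul, mul_smul] at h2
  change _ • _ - (_ + _) = _ at h2
  rw [mul_def, val_mk, sub_add_cancel_right, neg_eq_zero] at h2
  rw [← one_smul (DiffPoly δ) (f • _), ← map_one C, ← inv_mul_cancel₀ hc, map_mul, mul_smul, h2,
    smul_zero]

variable {m : ℕ}

theorem degree_val_mk_t_pow (hfm : f.natDegree = m) {d : ℕ} (hd : d < m) :
    degree (val (mk f (t ^ d))) = d := by
  rw [val_mk, modR_of_mem, degree_t_pow]
  change degree _ < _
  rw [degree_t_pow, hfm]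
  exact_mod_cast hd

theorem mem_rightNucleus_iff {w : W} (hf : f ≠ 0) (hfm : f.natDegree = m) (hm : 2 ≤ m)
    (hker : ∀ g : DiffPoly δ, g • w = 0 ↔ ∃ q, g = q * f)
    (hw : Submodule.span (DiffPoly δ) {w} = ⊤) {x : PetitAlgebra f} :
    x ∈ rightNucleus (PetitAlgebra f) ↔ f • evalAt f w x = 0 := by
  refine ⟨fun hx => ?_, associator_eq_zero_of_smul_eq_zero hf hker hw⟩
  -- The product t · t^(m−1) has degree m; both factors lie in S_f because m ≥ 2.
  refine smul_eq_zero_of_associator_eq_zero hf hker ?_ (hx (mk f (t ^ 1)) (mk f (t ^ (m - 1))))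
  rw [DiffPoly.degree_mul, degree_val_mk_t_pow hfm (by omega), degree_val_mk_t_pow hfm (by omega),
    ← Nat.cast_add, show 1 + (m - 1) = m by omega, ← hfm]
  exact (Polynomial.degree_eq_natDegree fun h => hf (toPoly_eq_zero.mp h)).symm

/-- If the right nucleus is not the whole algebra, then the left and middle nuclei consist of the
constants. -/
theorem leftNucleus_eq_and_middleNucleus_eq {w : W} (hf : f ≠ 0) (hfm : f.natDegree = m)
    (hm : 2 ≤ m) (hker : ∀ g : DiffPoly δ, g • w = 0 ↔ ∃ q, g = q * f)
    (hw : Submodule.span (DiffPoly δ) {w} = ⊤)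
    (hr : ∃ x : PetitAlgebra f, x ∉ rightNucleus (PetitAlgebra f)) :
    leftNucleus (PetitAlgebra f) = (const f).range ∧
      middleNucleus (PetitAlgebra f) = (const f).range := by
  obtain ⟨x, hx⟩ := hr
  have hf' : degree f = m :=
    hfm ▸ Polynomial.degree_eq_natDegree fun h => hf (toPoly_eq_zero.mp h)
  -- Multiplying a nonconstant y by a suitable t^d, on either side, reaches degree m exactly; d < m
  -- since deg y ≥ 1. An associator vanishing there would put the given x in the right nucleus.
  have hcompl : ∀ y : PetitAlgebra f, ¬ degree (val y) ≤ 0 → ∃ d, d < m ∧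
      degree (val y) + (d : WithBot ℕ) = degree f := fun y hy => by
    have hlt : degree (val y) < (m : WithBot ℕ) := hfm ▸ val_mem y
    have hne : degree (val y) ≠ ⊥ := fun h => hy (h ▸ bot_le)
    rw [degree, Polynomial.degree_eq_natDegree (mt Polynomial.degree_eq_bot.mpr hne)] at hy hlt ⊢
    set k := (toPoly (val y)).natDegree
    have h1 : k < m := by exact_mod_cast hlt
    have h2 : ¬ k ≤ 0 := fun h => hy (by exact_mod_cast h)
    refine ⟨m - k, by omega, ?_⟩
    rw [hf']
    have : k + (m - k) = m := by omega
    exact_mod_cast this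
  constructor
  · refine le_antisymm (fun y hy => mem_range_const (by omega) ?_) ?_
    · by_contra h
      obtain ⟨d, hd, hyd⟩ := hcompl y h
      refine hx (associator_eq_zero_of_smul_eq_zero hf hker hw
        (smul_eq_zero_of_associator_eq_zero hf hker ?_ (hy (mk f (t ^ d)) x)))
      rw [DiffPoly.degree_mul, degree_val_mk_t_pow hfm hd, hyd]
    · rintro _ ⟨c, rfl⟩
      exact const_mem_leftNucleus c
  · refine le_antisymm (fun y hy => mem_range_const (by omega) ?_) ?_
    · by_contra h
      obtain ⟨d, hd, hyd⟩ := hcompl y h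
      refine hx (associator_eq_zero_of_smul_eq_zero hf hker hw
        (smul_eq_zero_of_associator_eq_zero hf hker ?_ (hy (mk f (t ^ d)) x)))
      rw [DiffPoly.degree_mul, degree_val_mk_t_pow hfm hd, add_comm, hyd]
    · rintro _ ⟨c, rfl⟩
      exact const_mem_middleNucleus (by omega) c

/-- The right nucleus is anti-isomorphic to the endomorphism ring of the differential module. -/
theorem exists_equiv_rightNucleus {B : Type*} [Ring B] [Algebra F B] [Module F W]
    [IsScalarTower F K W] {w : W} (hf : f ≠ 0)
    (hfm : f.natDegree = m) (hm : 2 ≤ m) (hker : ∀ g : DiffPoly δ, g • w = 0 ↔ ∃ q, g = q * f)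
    (hw : Submodule.span (DiffPoly δ) {w} = ⊤) (R : B →ₗ[F] Module.End F W)
    (hRone : R 1 = 1) (hRmul : ∀ a b, R (a * b) = R b * R a)
    (hRinj : Function.Injective R)
    (hRcomm : ∀ b (p : DiffPoly δ) v, R b (p • v) = p • R b v)
    (hRsurj : ∀ T : W →ₗ[DiffPoly δ] W, ∃ b, ∀ v, R b v = T v) :
    Nonempty (B ≃ₐ[F] rightNucleus (PetitAlgebra f)) := by
  let ev := LinearEquiv.ofBijective (evalAt f w) (evalAt_bijective hf hker hw)
  have hev : ∀ x, evalAt f w x = ev x := fun x => rfl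
  have hfw : f • w = 0 := (hker f).mpr ⟨1, (one_mul f).symm⟩
  have hmem : ∀ b, ev.symm (R b w) ∈ rightNucleus (PetitAlgebra f) := fun b => by
    rw [mem_rightNucleus_iff hf hfm hm hker hw, hev, ev.apply_symm_apply, ← hRcomm, hfw, map_zero]
  -- Evaluation at w also reverses the order: a∘b goes to a (R_b w) = R_b R_a w. The two reversals
  -- cancel.
  have hmul : ∀ a b, ev.symm (R (a * b) w) = ev.symm (R a w) * ev.symm (R b w) := fun a b => by
    rw [ev.symm_apply_eq, ← hev, evalAt_mul hf hker, hev, ev.apply_symm_apply, ← hRcomm,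
      ← evalAt_apply, hev, ev.apply_symm_apply, hRmul]
    rfl
  have hone : ev.symm (R 1 w) = 1 := by
    rw [ev.symm_apply_eq, ← hev, one_def, evalAt_mk hf hker, one_smul, hRone]
    rfl
  have hsm : ∀ (c : F) b, ev.symm (R (c • b) w) = c • ev.symm (R b w) := fun c b => by
    rw [map_smul, LinearMap.smul_apply, ← algebraMap_smul K c, map_smul, algebraMap_smul]
  let g : B →ₐ[F] rightNucleus (PetitAlgebra f) := AlgHom.ofLinearMap
    { toFun b := ⟨ev.symm (R b w), hmem b⟩
      map_add' a b := Subtype.ext (by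
        change ev.symm (R (a + b) w) = ev.symm (R a w) + ev.symm (R b w)
        rw [map_add, LinearMap.add_apply, map_add])
      map_smul' c b := Subtype.ext (hsm c b) }
    (Subtype.ext hone) (fun a b => Subtype.ext (hmul a b))
  have hg : ∀ b, (g b : PetitAlgebra f) = ev.symm (R b w) := fun b => rfl
  refine ⟨AlgEquiv.ofBijective g ⟨fun a b hab => hRinj ?_, fun x => ?_⟩⟩
  · have h1 : R a w = R b w := ev.symm.injective (congrArg Subtype.val hab)
    ext v
    obtain ⟨p, rfl⟩ := Submodule.mem_span_singleton.mp (hw ▸ Submodule.mem_top : v ∈ _)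
    rw [hRcomm, hRcomm, h1]
  · have hx := (mem_rightNucleus_iff hf hfm hm hker hw).mp x.2
    have hann : ∀ p : DiffPoly δ, p • w = 0 → p • ev x = 0 := fun p hp => by
      obtain ⟨q, rfl⟩ := (hker p).mp hp
      rw [mul_smul, ← hev, hx, smul_zero]
    have hval : ∀ v, val (ev.symm v) • w = v := fun v => ev.apply_symm_apply v
    -- The endomorphism p w ↦ p (x w). It is well defined because everything killing w is a left
    -- multiple of f, and f kills x w.
    let T : W →ₗ[DiffPoly δ] W :=
      { toFun v := val (ev.symm v) • ev x
        map_add' u v := by rw [map_add, map_add, add_smul]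
        map_smul' p v := by
          rw [RingHom.id_apply, ← mul_smul, ← sub_eq_zero, ← sub_smul]
          refine hann _ ?_
          rw [sub_smul, hval, mul_smul, hval, sub_self] }
    obtain ⟨b, hb⟩ := hRsurj T
    refine ⟨b, Subtype.ext ?_⟩
    rw [hg, hb, ev.symm_apply_eq]
    change val (ev.symm w) • ev x = ev x
    conv_rhs => rw [← one_smul (DiffPoly δ) (ev x)]
    rw [← sub_eq_zero, ← sub_smul]
    exact hann _ (by rw [sub_smul, hval, one_smul, sub_self])

end

end PetitAlgebra

/-- Bijective additive multiplicative maps permute the right nucleus. -/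
theorem rightNucleus.apply_mem {A : Type*} [NonAssocRing A] (H : A ≃+* A) {x : A}
    (hx : x ∈ rightNucleus A) : H x ∈ rightNucleus A := fun y z => by
  have h := congrArg H (hx (H.symm y) (H.symm z))
  rw [associator_apply] at h ⊢
  simpa using h

/-- The automorphism of the right nucleus induced by an automorphism of the algebra. -/
def rightNucleus.congr {F A : Type*} [CommRing F] [NonAssocRing A] [Module F A]
    [SMulCommClass F A A] [IsScalarTower F A A] (H : A ≃+* A)
    (hH : ∀ (c : F) x, H (c • x) = c • H x) : rightNucleus A ≃ₐ[F] rightNucleus A :=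
  AlgEquiv.ofLinearEquiv
    { toFun x := ⟨H x, rightNucleus.apply_mem H x.2⟩
      invFun x := ⟨H.symm x, rightNucleus.apply_mem H.symm x.2⟩
      left_inv _ := Subtype.ext (H.symm_apply_apply _)
      right_inv _ := Subtype.ext (H.apply_symm_apply _)
      map_add' _ _ := Subtype.ext (map_add H _ _)
      map_smul' c x := Subtype.ext (hH c x) }
    (Subtype.ext (map_one H)) (fun _ _ => Subtype.ext (map_mul H _ _))

end

/-! ### Assembly: the connection D(w) = δw + wP. -/

theorem mainTheorem1 {F K B : Type*} [Field F] [CharZero F] [Field K] [Algebra F K]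
    [Ring B] [Algebra F B] [FiniteDimensional F B] [Algebra.IsCentral F B] [IsSimpleRing B]
    (m : ℕ) (hm : 2 ≤ m) (hdeg : Module.finrank F B = m ^ 2)
    (hclosed : ∀ x : K, IsAlgebraic F x → x ∈ Set.range (algebraMap F K))
    (hne : ∃ x : K, x ∉ Set.range (algebraMap F K))
    (hsplit : Nonempty (K ⊗[F] B ≃ₐ[K] Matrix (Fin m) (Fin m) K)) :
    ∃ δ : Derivation F K K, (∀ a : K, δ a = 0 ↔ a ∈ Set.range (algebraMap F K)) ∧
      ∃ f : DiffPoly δ, f.degree = m ∧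
        ¬ FiniteDimensional F (PetitAlgebra f) ∧
        leftNucleus (PetitAlgebra f) = (PetitAlgebra.const f).range ∧
        middleNucleus (PetitAlgebra f) = (PetitAlgebra.const f).range ∧
        ∃ e : B ≃ₐ[F] rightNucleus (PetitAlgebra f),
          ∀ H : PetitAlgebra f ≃+* PetitAlgebra f, (∀ (c : F) x, H (c • x) = c • H x) →
            ∃ u : Bˣ, ∀ b : B,
              H (e b : PetitAlgebra f) = (e (u * b * (u⁻¹ : Bˣ)) : PetitAlgebra f) := by
  obtain ⟨ψ⟩ := hsplit
  obtain ⟨δ, hδ⟩ := exists_derivation_constants_eq hclosed hne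
  refine ⟨δ, hδ, ?_⟩
  have : CharZero K := charZero_of_injective_algebraMap (algebraMap F K).injective
  obtain ⟨P, hP⟩ := exists_horizontal_iff (⟨0, by omega⟩ : Fin m) δ hδ ψ
  let D : Module.End F (Fin m → K) :=
    { toFun w := (fun i => δ (w i)) + Matrix.vecMul w P
      map_add' u v := by
        rw [Matrix.add_vecMul]
        ext i
        simp only [Pi.add_apply, map_add]
        ring
      map_smul' c v := by
        rw [Matrix.smul_vecMul]
        ext i
        simp }
  have hDa : ∀ w, D w = (fun i => δ (w i)) + Matrix.vecMul w P := fun w => rfl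
  have hD : ∀ (a : K) w, D (a • w) = a • D w + δ a • w := fun a w => by
    rw [hDa, hDa, Matrix.smul_vecMul]
    ext i
    simp only [Pi.add_apply, Pi.smul_apply, Derivation.leibniz, smul_eq_mul]
    ring
  let : Module (DiffPoly δ) (Fin m → K) := Module.compHom (Fin m → K) (DiffPoly.connectionHom D hD)
  have hact : ∀ (p : DiffPoly δ) (w : Fin m → K), p • w = DiffPoly.connectionHom D hD p w :=
    fun p w => rfl
  have hCact : ∀ (a : K) (w : Fin m → K), (DiffPoly.C a : DiffPoly δ) • w = a • w :=
    DiffPoly.connectionHom_C D hD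
  have htact : ∀ (w : Fin m → K), (DiffPoly.t : DiffPoly δ) • w = D w := fun w => by
    rw [hact, DiffPoly.connectionHom_t]
  have : IsScalarTower K (DiffPoly δ) (Fin m → K) := ⟨fun a p w => by
    rw [← DiffPoly.C_mul, mul_smul, hCact]⟩
  obtain ⟨w, hw⟩ := DiffPoly.exists_cyclic (δ := δ) (W := Fin m → K) (by
    obtain ⟨x, hx⟩ := hne
    exact ⟨x, fun h => hx ((hδ x).mp h)⟩)
  obtain ⟨f, hf, hfm, hker⟩ := DiffPoly.exists_annihilator hw
  rw [Module.finrank_fin_fun] at hfm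
  have hfin := PetitAlgebra.not_finite (f := f) (by omega) hclosed hne
  -- The discrepancy D(wX) − D(w)X is w (δX − (PX − XP)), tested on the standard basis vectors.
  have hcommD : ∀ X : Matrix (Fin m) (Fin m) K,
      (∀ w : Fin m → K, Matrix.vecMul (D w) X = D (Matrix.vecMul w X)) ↔ X.map δ = P * X - X * P := by
    intro X
    have h1 : ∀ w : Fin m → K, D (Matrix.vecMul w X) =
        Matrix.vecMul (D w) X + Matrix.vecMul w (X.map δ - (P * X - X * P)) := fun w => by
      have h2 : (fun i => δ (Matrix.vecMul w X i)) =
          Matrix.vecMul (fun i => δ (w i)) X + Matrix.vecMul w (X.map δ) := by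
        ext i
        simp only [Matrix.vecMul, dotProduct, map_sum, Derivation.leibniz, Pi.add_apply,
          Matrix.map_apply, ← Finset.sum_add_distrib, smul_eq_mul]
        exact Finset.sum_congr rfl fun j _ => by ring
      rw [hDa, hDa, h2, Matrix.vecMul_sub, Matrix.vecMul_sub, Matrix.add_vecMul,
        Matrix.vecMul_vecMul, Matrix.vecMul_vecMul]
      abel
    constructor
    · intro h
      rw [← sub_eq_zero]
      refine Matrix.ext_of_single_vecMul fun i => ?_
      have h3 := h1 (Pi.single i 1)
      rw [h, left_eq_add] at h3
      rw [h3, Matrix.vecMul_zero]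
    · intro h w
      rw [h1, h, sub_self, Matrix.vecMul_zero, add_zero]
  -- B acts on row vectors from the right, so `R` reverses products.
  let R : B →ₗ[F] Module.End F (Fin m → K) :=
    { toFun b := (Matrix.vecMulLinear (ψ (1 ⊗ₜ b))).restrictScalars F
      map_add' a b := by
        refine LinearMap.ext fun v => ?_
        simp [TensorProduct.tmul_add]
      map_smul' c b := by
        have h : ψ (1 ⊗ₜ (c • b)) = c • ψ (1 ⊗ₜ b) := by
          rw [TensorProduct.tmul_smul, ← algebraMap_smul K c, map_smul, algebraMap_smul]
        refine LinearMap.ext fun v => ?_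
        change Matrix.vecMul v _ = c • Matrix.vecMul v _
        rw [h, Matrix.vecMul_smul] }
  have hR : ∀ b w, R b w = Matrix.vecMul w (ψ (1 ⊗ₜ b)) := fun b w => rfl
  obtain ⟨e⟩ := PetitAlgebra.exists_equiv_rightNucleus hf hfm hm hker hw R
    (by
      refine LinearMap.ext fun v => ?_
      rw [hR, ← Algebra.TensorProduct.one_def, map_one, Matrix.vecMul_one]
      rfl)
    (fun a b => by
      refine LinearMap.ext fun v => ?_
      rw [Module.End.mul_apply, hR, hR, hR, Matrix.vecMul_vecMul, ← map_mul,
        Algebra.TensorProduct.tmul_mul_tmul, one_mul])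
    (fun a b hab => by
      have h1 : ψ (1 ⊗ₜ a) = ψ (1 ⊗ₜ b) := Matrix.ext_of_single_vecMul fun i => by
        rw [← hR, ← hR, hab]
      exact Algebra.TensorProduct.includeRight_injective (A := K)
        (FaithfulSMul.algebraMap_injective F K) (ψ.injective h1))
    (fun b p v => by
      have h1 : ∀ v, R b (D v) = D (R b v) := (hcommD _).mpr ((hP _).mpr ⟨b, rfl⟩)
      exact DiffPoly.connectionHom_comm D hD (R b) (fun a v => Matrix.smul_vecMul a v _) h1 p v)
    (fun T => by
      let T' : (Fin m → K) →ₗ[K] Fin m → K := T.restrictScalars K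
      have h1 : ∀ v, Matrix.vecMul v (LinearMap.toMatrix' T').transpose = T v := fun v => by
        rw [Matrix.vecMul_transpose, LinearMap.toMatrix'_mulVec]
        rfl
      obtain ⟨b, hb⟩ := (hP (LinearMap.toMatrix' T').transpose).mp ((hcommD _).mp fun v => by
        rw [h1, h1, ← htact, ← htact, map_smul])
      exact ⟨b, fun v => by rw [hR, hb, h1]⟩)
  -- If the right nucleus were everything, S_f would be a quotient space of the finite-dimensional
  -- B.
  obtain ⟨hl, hmid⟩ := PetitAlgebra.leftNucleus_eq_and_middleNucleus_eq hf hfm hm hker hw (by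
    by_contra! hall
    refine hfin (Module.Finite.of_surjective
      (⟨⟨fun b => (e b : PetitAlgebra f), fun a b => congrArg Subtype.val (map_add e a b)⟩,
        fun c b => congrArg Subtype.val (map_smul e c b)⟩ : B →ₗ[F] PetitAlgebra f) fun x => ?_)
    exact ⟨e.symm ⟨x, hall x⟩, congrArg Subtype.val (e.apply_symm_apply _)⟩)
  refine ⟨f, ?_, hfin, hl, hmid, e, fun H hH => ?_⟩
  · rw [← hfm]
    exact Polynomial.degree_eq_natDegree fun h => hf (DiffPoly.toPoly_eq_zero.mp h)
  · obtain ⟨u, hu⟩ := AlgEquiv.exists_conj_of_split ψ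
      ((e.trans (rightNucleus.congr H hH)).trans e.symm)
    refine ⟨u, fun b => ?_⟩
    rw [← hu]
    simp only [AlgEquiv.trans_apply, AlgEquiv.apply_symm_apply]
    rfl
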